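/- Let $k$ be a perfect field and let $A$ be a finite-dimensional associative (not necessarily unital) or Lie algebra over $k$ with product $\mu$. An algebra filtration of $A$ is a decreasing family of subspaces $F_m\subseteq A$ ($m\in\mathbb Z$) with $\mu(F_i,F_j)\subseteq F_{i+j}$, $F_m=A$ for $m\ll 0$ and $F_m=0$ for $m\gg 0$; it is trivial if $F_m=A$ for $m\le 0$ and $F_m=0$ for $m>0$. Put $\mathrm{wt}(F)=\sum_m m\dim(F_m/F_{m+1})$, $\|F\|=\big(\sum_m m^2\dim(F_m/F_{m+1})\big)^{1/2}$ and $\nu(F)=-\mathrm{wt}(F)/\|F\|$. The algebra $A$ is semistable if $-\mathrm{wt}(F)\ge 0$ for all $F$. A filtration is canonical if it is the trivial filtration when $A$ is semistable, and if it is a nontrivial filtration that minimizes $\nu$ among all nontrivial filtrations when $A$ is not semistable (so canonical filtrations are considered up to positive rescaling of the weights). A grading operator $\varphi$ of $A$ is a $\mathbb Z$-grading $A=\bigoplus_i A^\varphi_i$ as an algebra, equivalently a one-parameter subgroup $\varphi(t)$ of $\mathrm{Aut}(A)$, acting by $t^i$ on $A^\varphi_i$; it is trivial if $A^\varphi_0=A$.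 Its split filtration is $F(\varphi)_m=\bigoplus_{d\ge m}A^\varphi_d$, and we say that $\varphi$ defines the filtration $F(\varphi)$. Let $\mathrm{GTrace}(\varphi)=\sum_i i\dim A^\varphi_i$, let $C(\varphi)$ be the set of grading operators that commute with $\varphi$ (as one-parameter subgroups), and for commuting $\varphi,\psi$ let $\mathrm{GTrace}(\varphi\circ\psi)=B(\varphi,\psi)=\sum_{i,j} ij\,\dim(A^\varphi_i\cap A^\psi_j)$ and $\|\varphi\|_B=B(\varphi,\varphi)^{1/2}$. Let $A_\bullet$ be a $\mathbb Z$-grading of $A$ that is graded-semistable, i.e. whose split filtration $F^{\mathrm{Can}}$ is canonical, and let $\varphi$ be any nontrivial grading operator of $A$. Then: 1. There is a grading operator $\varphi_{\mathrm{Can}}\in C(\varphi)$ that defines the canonical filtration: $F(\varphi_{\mathrm{Can}})=F^{\mathrm{Can}}$. Moreover, for every $\psi\in C(\varphi)$ there is such a $\varphi_{\mathrm{Can}}\in C(\varphi)$ that also commutes with $\psi$. 2. If the grading $A_\bullet$ is nontrivial, then every grading operator $\varphi_{\mathrm{Can}}$ that defines a canonical filtration has $\mathrm{GTrace}(\varphi_{\mathrm{Can}})>0$,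 and for every $\psi\in C(\varphi)$ that commutes with $\varphi_{\mathrm{Can}}$, $$\mathrm{GTrace}(\varphi_{\mathrm{Can}}\circ\psi)=\frac{\|\varphi_{\mathrm{Can}}\|_B^2}{\mathrm{GTrace}(\varphi_{\mathrm{Can}})}\,\mathrm{GTrace}(\psi).$$ -/

import Mathlib

universe u v

/-- A bilinear product is associative (no unit is required). -/
def IsAssocProduct {k : Type u} {V : Type v} [Field k] [AddCommGroup V] [Module k V]
    (μ : V →ₗ[k] V →ₗ[k] V) : Prop :=
  ∀ x y z : V, μ (μ x y) z = μ x (μ y z)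

/-- A bilinear product is a Lie bracket: alternating, with the Jacobi identity. -/
def IsLieProduct {k : Type u} {V : Type v} [Field k] [AddCommGroup V] [Module k V]
    (μ : V →ₗ[k] V →ₗ[k] V) : Prop :=
  (∀ x : V, μ x x = 0) ∧
    ∀ x y z : V, μ x (μ y z) + μ y (μ z x) + μ z (μ x y) = 0

/-- An algebra filtration of `(V, μ)`: a decreasing, bounded, multiplicative `ℤ`-indexed family of
subspaces. -/
structure AlgFiltration {k : Type u} {V : Type v} [Field k] [AddCommGroup V] [Module k V]
    (μ : V →ₗ[k] V →ₗ[k] V) where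
  /-- the subspaces `F_m` -/
  part : ℤ → Submodule k V
  anti : ∀ i j : ℤ, i ≤ j → part j ≤ part i
  mul_mem : ∀ (i j : ℤ) (x y : V), x ∈ part i → y ∈ part j → μ x y ∈ part (i + j)
  eventually_top : ∃ N : ℤ, ∀ i : ℤ, i ≤ N → part i = ⊤
  eventually_bot : ∃ N : ℤ, ∀ i : ℤ, N ≤ i → part i = ⊥

namespace AlgFiltration

variable {k : Type u} {V : Type v} [Field k] [AddCommGroup V] [Module k V]
  {μ : V →ₗ[k] V →ₗ[k] V}

/-- `dim (F_m / F_{m+1})`. -/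
noncomputable def grDim (F : AlgFiltration μ) (m : ℤ) : ℕ :=
  Module.finrank k (F.part m ⧸ (F.part (m + 1)).submoduleOf (F.part m))

/-- The weight `∑ m · dim (F_m / F_{m+1})`. -/
noncomputable def wt (F : AlgFiltration μ) : ℝ :=
  ∑ᶠ m : ℤ, (m : ℝ) * (F.grDim m : ℝ)

/-- The norm `(∑ m² · dim (F_m / F_{m+1}))^{1/2}`. -/
noncomputable def norm (F : AlgFiltration μ) : ℝ :=
  Real.sqrt (∑ᶠ m : ℤ, (m : ℝ) ^ 2 * (F.grDim m : ℝ))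

/-- The numerical invariant `ν = - wt / norm`. -/
noncomputable def numInvariant (F : AlgFiltration μ) : ℝ :=
  -F.wt / F.norm

/-- The trivial filtration: everything in degree `0`. -/
def IsTrivial (F : AlgFiltration μ) : Prop :=
  (∀ n : ℤ, n ≤ 0 → F.part n = ⊤) ∧ ∀ n : ℤ, 0 < n → F.part n = ⊥

end AlgFiltration

/-- Semistability of the algebra `(V, μ)`: `- wt ≥ 0` for all filtrations. -/
def AlgSemistable {k : Type u} {V : Type v} [Field k] [AddCommGroup V] [Module k V]
    (μ : V →ₗ[k] V →ₗ[k] V) : Prop :=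
  ∀ F : AlgFiltration μ, 0 ≤ -F.wt

/-- `F` is the canonical filtration of `(V, μ)`: the trivial filtration if the algebra is
semistable, and a minimizer of `ν` among the nontrivial filtrations if it is unstable.
(`ν` does not change when all weights are multiplied by a positive integer, so the minimizer is
meant up to such a rescaling.) -/
def AlgFiltration.IsCanonical {k : Type u} {V : Type v} [Field k] [AddCommGroup V] [Module k V]
    {μ : V →ₗ[k] V →ₗ[k] V} (F : AlgFiltration μ) : Prop :=
  (AlgSemistable μ ∧ F.IsTrivial) ∨
    (¬ AlgSemistable μ ∧ ¬ F.IsTrivial ∧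
      ∀ G : AlgFiltration μ, ¬ G.IsTrivial → F.numInvariant ≤ G.numInvariant)

/-- A grading operator of the algebra `(V, μ)`, given by the `ℤ`-grading it is equivalent to:
the corresponding one-parameter subgroup of `Aut (V, μ)` acts by `t ^ i` on `piece i`. -/
structure GradingOperator {k : Type u} {V : Type v} [Field k] [AddCommGroup V] [Module k V]
    (μ : V →ₗ[k] V →ₗ[k] V) where
  /-- the homogeneous components -/
  piece : ℤ → Submodule k V
  isInternal : DirectSum.IsInternal piece
  mul_mem : ∀ (i j : ℤ) (x y : V), x ∈ piece i → y ∈ piece j → μ x y ∈ piece (i + j)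

namespace GradingOperator

variable {k : Type u} {V : Type v} [Field k] [AddCommGroup V] [Module k V]
  {μ : V →ₗ[k] V →ₗ[k] V}

/-- The projection of `V` onto the component of degree `i`. -/
noncomputable def proj (φ : GradingOperator μ) (i : ℤ) : Module.End k V :=
  (φ.piece i).subtype ∘ₗ DirectSum.component k ℤ (fun j => φ.piece j) i ∘ₗ
    (LinearEquiv.ofBijective (DirectSum.coeLinearMap φ.piece) φ.isInternal).symm.toLinearMap

/-- The grading is concentrated in degree `0`, that is, `φ = id`. -/
def IsTrivial (φ : GradingOperator μ) : Prop :=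
  φ.piece 0 = ⊤

/-- The grading trace: the sum of the degrees of the elements of a homogeneous basis. -/
noncomputable def gtrace (φ : GradingOperator μ) : ℤ :=
  ∑ᶠ i : ℤ, i * (Module.finrank k (φ.piece i) : ℤ)

/-- The one-parameter subgroups `φ(t) = ∑ tⁱ pᵢ` and `ψ(s) = ∑ sʲ qⱼ` (with `pᵢ`, `qⱼ` the
projections) commute. Comparing the coefficients of `tⁱ sʲ`, `φ(t) ψ(s) = ψ(s) φ(t)` says that all
`pᵢ` commute with all `qⱼ`. -/
def Commutes (φ ψ : GradingOperator μ) : Prop :=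
  ∀ i j : ℤ, Commute (φ.proj i) (ψ.proj j)

/-- `C(φ)`: the grading operators that commute with `φ`. -/
def centralizer (φ : GradingOperator μ) : Set (GradingOperator μ) :=
  {ψ | φ.Commutes ψ}

/-- `GTrace (φ ∘ ψ) = B (φ, ψ)` for commuting `φ`, `ψ`: the sum, over a basis of simultaneously
homogeneous elements, of the products of the two degrees. The space with degrees `(i, j)` is
`φ.piece i ⊓ ψ.piece j`. -/
noncomputable def gtraceComp (φ ψ : GradingOperator μ) : ℤ :=
  ∑ᶠ p : ℤ × ℤ,
    p.1 * p.2 * (Module.finrank k (φ.piece p.1 ⊓ ψ.piece p.2 : Submodule k V) : ℤ)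

/-- The norm `‖φ‖_B` of the inner product `B`. -/
noncomputable def normB (φ : GradingOperator μ) : ℝ :=
  Real.sqrt (φ.gtraceComp φ : ℝ)

/-- Only finitely many components are nonzero. -/
theorem finite_support [FiniteDimensional k V] (φ : GradingOperator μ) :
    {i : ℤ | φ.piece i ≠ ⊥}.Finite :=
  WellFoundedGT.finite_ne_bot_of_iSupIndep φ.isInternal.submodule_iSupIndep

/-- The split filtration `F_m = ⨁_{d ≥ m} A_d` of the grading. -/
def splitFiltration [FiniteDimensional k V] (φ : GradingOperator μ) : AlgFiltration μ where
  part m := ⨆ d : ℤ, ⨆ _ : m ≤ d, φ.piece d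
  anti i j h := iSup₂_le fun d hd => le_iSup₂_of_le d (h.trans hd) le_rfl
  mul_mem i j x y hx hy := by
    have hxy : (⨆ d : ℤ, ⨆ _ : i ≤ d, φ.piece d) ≤
        (⨆ d : ℤ, ⨆ _ : i + j ≤ d, φ.piece d).comap (μ.flip y) := by
      refine iSup₂_le fun d hd a ha => ?_
      have h2 : (⨆ d : ℤ, ⨆ _ : j ≤ d, φ.piece d) ≤
          (⨆ d : ℤ, ⨆ _ : i + j ≤ d, φ.piece d).comap (μ a) := by
        refine iSup₂_le fun e he b hb => ?_
        have h3 : φ.piece (d + e) ≤ ⨆ d : ℤ, ⨆ _ : i + j ≤ d, φ.piece d :=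
          le_iSup₂_of_le (d + e) (add_le_add hd he) le_rfl
        exact h3 (φ.mul_mem d e a b ha hb)
      exact h2 hy
    exact hxy hx
  eventually_top := by
    obtain ⟨N, hN⟩ := φ.finite_support.bddBelow
    refine ⟨N, fun i hi => ?_⟩
    rw [eq_top_iff, ← φ.isInternal.submodule_iSup_eq_top]
    refine iSup_le fun d => ?_
    by_cases hd : φ.piece d = ⊥
    · rw [hd]; exact bot_le
    · exact le_iSup₂_of_le d (hi.trans (hN hd)) le_rfl
  eventually_bot := by
    obtain ⟨N, hN⟩ := φ.finite_support.bddAbove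
    refine ⟨N + 1, fun i hi => ?_⟩
    rw [eq_bot_iff]
    refine iSup₂_le fun d hd => ?_
    by_cases h : φ.piece d = ⊥
    · rw [h]
    · have h1 : d ≤ N := hN h
      omega

/-- The graded algebra is graded-semistable: its split filtration is the canonical filtration. -/
def GradedSemistable [FiniteDimensional k V] (φ : GradingOperator μ) : Prop :=
  φ.splitFiltration.IsCanonical

end GradingOperator

/-! The canonical filtration is rigid, and rigidity makes it homogeneous for every grading. Any two
filtrations have a common weighted basis (`exists_common_weighted_basis`), in which multiplicativity
is a condition on structure constants and weights. Adding the weights of two algebra filtrations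
gives another one. By the parallelogram law, a maximizer of weight over norm is therefore determined
by its weight and norm (`IsCanonical.eq_of_wt_eq_of_norm_eq`).

Given a grading `φ`, replace the vectors of a basis adapted to both `F` and the split filtration of
`φ` by their leading `φ`-components and keep the `F`-weights. The result is a `φ`-homogeneous
algebra filtration with the weight and norm of `F`, so it is `F`
(`proj_mem_stabilizer_of_isCanonical`). In the semistable case `F` is trivial and every endomorphism
preserves it.

Let `A` split `F`. The grading induced by `φ` on the associated graded algebra transports through
`A` to a grading `φ'` that commutes with `A`. Since `φ` and `φ'` agree modulo a shift of `F`, an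
automorphism `g` of the filtered algebra carries `φ'` to `φ`, and `g A g⁻¹` splits `F` and commutes
with `φ`. The construction uses only the projections, so it commutes with whatever commutes with `A`
and `φ`. A second application, to `ψ`, thus keeps the commutation with `φ`.

The trace identity is the vanishing of the first variation of weight over norm along `ψ`. -/

/-! ### Filtrations in terms of weighted bases -/

section WeightedBasis

variable {k : Type u} {V : Type v} [Field k] [AddCommGroup V] [Module k V]
  {μ : V →ₗ[k] V →ₗ[k] V} {ι : Type*}

/-- The subspace of a weighted basis spanned by the vectors of weight at least `m`. -/
def Module.Basis.weightGE (e : Module.Basis ι k V) (f : ι → ℤ) (m : ℤ) : Submodule k V where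
  carrier := {x | ∀ a, f a < m → e.repr x a = 0}
  add_mem' := by
    intro x y hx hy a ha
    simp [hx a ha, hy a ha]
  zero_mem' := by
    intro a _
    simp
  smul_mem' := by
    intro c x hx a ha
    simp [hx a ha]

theorem Module.Basis.mem_weightGE {e : Module.Basis ι k V} {f : ι → ℤ} {m : ℤ} {x : V} :
    x ∈ e.weightGE f m ↔ ∀ a, f a < m → e.repr x a = 0 := Iff.rfl

theorem Module.Basis.weightGE_eq_span (e : Module.Basis ι k V) (f : ι → ℤ) (m : ℤ) :
    e.weightGE f m = Submodule.span k (e '' {a | m ≤ f a}) := by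
  ext x
  rw [Module.Basis.mem_span_image, Module.Basis.mem_weightGE]
  constructor
  · intro h a ha
    by_contra hn
    simp only [Set.mem_ofPred_eq, not_le] at hn
    exact (Finsupp.mem_support_iff.1 ha) (h a hn)
  · intro h a ha
    by_contra hn
    exact absurd (h (Finsupp.mem_support_iff.2 hn)) (not_le.2 ha)

theorem Module.Basis.self_mem_weightGE (e : Module.Basis ι k V) (f : ι → ℤ) {m : ℤ} {a : ι}
    (h : m ≤ f a) : e a ∈ e.weightGE f m := by
  intro b hb
  rw [e.repr_self, Finsupp.single_eq_of_ne]
  rintro rfl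
  omega

theorem Module.Basis.finrank_span_image [Fintype ι] (e : Module.Basis ι k V) (P : ι → Prop)
    [DecidablePred P] :
    Module.finrank k (Submodule.span k (e '' {a | P a})) = (Finset.univ.filter P).card := by
  rw [Set.image_eq_range, ← Fintype.card_subtype]
  exact finrank_span_eq_card (R := k) (b := fun a : {a // P a} => e a)
    (e.linearIndependent.comp _ Subtype.val_injective)

theorem Module.Basis.finrank_weightGE [Fintype ι] (e : Module.Basis ι k V) (f : ι → ℤ) (m : ℤ) :
    Module.finrank k (e.weightGE f m) = (Finset.univ.filter fun a => m ≤ f a).card := by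
  rw [e.weightGE_eq_span, e.finrank_span_image]

/-- A finite sum over values weighted by the sizes of the fibres. -/
theorem finsum_mul_card_fiber [Fintype ι] {κ R : Type*} [DecidableEq κ] [CommSemiring R]
    (f : ι → κ) (h : κ → R) :
    ∑ᶠ m, h m * ((Finset.univ.filter fun a => f a = m).card : R) = ∑ a, h (f a) := by
  rw [finsum_eq_sum_of_support_subset (s := Finset.univ.image f), Finset.sum_comp]
  · refine Finset.sum_congr rfl fun m _ => ?_
    rw [nsmul_eq_mul, mul_comm]
  · intro m hm
    rw [Function.mem_support] at hm
    by_contra hn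
    apply hm
    have : (Finset.univ.filter fun a => f a = m) = ∅ := by
      rw [Finset.filter_eq_empty_iff]
      intro a _ ha
      exact hn (by simp [← ha])
    simp [this]

namespace AlgFiltration

/-- `F` is spanned in each degree by the basis vectors of large enough weight. -/
def IsAdapted (F : AlgFiltration μ) (e : Module.Basis ι k V) (f : ι → ℤ) : Prop :=
  ∀ m, F.part m = e.weightGE f m

/-- Multiplicativity read off structure constants. The converse is `ofBasis`, so new algebra
filtrations arise just by changing weights. -/
theorem IsAdapted.repr_mul_eq_zero {F : AlgFiltration μ} {e : Module.Basis ι k V} {f : ι → ℤ}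
    (h : F.IsAdapted e f) {a b c : ι} (hc : f c < f a + f b) :
    e.repr (μ (e a) (e b)) c = 0 := by
  have h1 := F.mul_mem (f a) (f b) (e a) (e b)
    (by rw [h]; exact e.self_mem_weightGE f le_rfl) (by rw [h]; exact e.self_mem_weightGE f le_rfl)
  rw [h] at h1
  exact h1 c hc

/-- The algebra filtration given by a weighted basis. -/
def ofBasis [Fintype ι] (e : Module.Basis ι k V) (f : ι → ℤ)
    (h : ∀ a b c, f c < f a + f b → e.repr (μ (e a) (e b)) c = 0) : AlgFiltration μ where
  part := e.weightGE f
  anti i j hij x hx a ha := hx a (ha.trans_le hij)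
  mul_mem i j x y hx hy c hc := by
    have h1 : e.repr (μ x y) c
        = ∑ a, ∑ b, e.repr x a * (e.repr y b * e.repr (μ (e a) (e b)) c) := by
      conv_lhs => rw [← e.sum_repr x, ← e.sum_repr y]
      simp only [map_sum, LinearMap.sum_apply, map_smul, LinearMap.smul_apply,
        Finsupp.coe_finsetSum, Finset.sum_apply, Finsupp.smul_apply, smul_eq_mul, Finset.mul_sum]
      rw [Finset.sum_comm]
      refine Finset.sum_congr rfl fun a _ => Finset.sum_congr rfl fun b _ => by ring
    rw [h1]
    refine Finset.sum_eq_zero fun a _ => Finset.sum_eq_zero fun b _ => ?_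
    rcases lt_or_ge (f a) i with ha | ha
    · rw [hx a ha, zero_mul]
    rcases lt_or_ge (f b) j with hb | hb
    · rw [hy b hb, zero_mul, mul_zero]
    rw [h a b c (by omega), mul_zero, mul_zero]
  eventually_top := by
    obtain ⟨N, hN⟩ := (Set.finite_range f).bddBelow
    refine ⟨N, fun i hi => eq_top_iff.2 fun x _ a ha => ?_⟩
    have := hN ⟨a, rfl⟩
    omega
  eventually_bot := by
    obtain ⟨N, hN⟩ := (Set.finite_range f).bddAbove
    refine ⟨N + 1, fun i hi => eq_bot_iff.2 fun x hx => ?_⟩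
    rw [Submodule.mem_bot, ← e.forall_coord_eq_zero_iff]
    intro a
    have := hN ⟨a, rfl⟩
    exact hx a (by omega)

theorem ofBasis_isAdapted [Fintype ι] (e : Module.Basis ι k V) (f : ι → ℤ)
    (h : ∀ a b c, f c < f a + f b → e.repr (μ (e a) (e b)) c = 0) :
    (ofBasis e f h).IsAdapted e f := fun _ => rfl

variable {F : AlgFiltration μ} {e : Module.Basis ι k V} {f : ι → ℤ}

theorem IsAdapted.grDim_eq [Fintype ι] (h : F.IsAdapted e f) (m : ℤ) :
    F.grDim m = (Finset.univ.filter fun a => f a = m).card := by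
  have : FiniteDimensional k V := Module.Basis.finiteDimensional_of_finite e
  have h1 := Submodule.finrank_quotient_add_finrank ((F.part (m + 1)).submoduleOf (F.part m))
  have h2 := (Submodule.submoduleOfEquivOfLe (F.anti m (m + 1) (by omega))).finrank_eq
  rw [h2, h m, h (m + 1), e.finrank_weightGE, e.finrank_weightGE] at h1
  have h3 : (Finset.univ.filter fun a => m ≤ f a).card
      = (Finset.univ.filter fun a => f a = m).card
        + (Finset.univ.filter fun a => m + 1 ≤ f a).card := by
    classical
    rw [← Finset.card_union_of_disjoint]
    · congr 1
      ext a
      simp only [Finset.mem_filter, Finset.mem_univ, true_and, Finset.mem_union]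
      omega
    · rw [Finset.disjoint_filter]
      intro a _ h1
      omega
  unfold grDim
  rw [h m, h (m + 1)]
  omega

theorem IsAdapted.wt_eq [Fintype ι] (h : F.IsAdapted e f) : F.wt = ∑ a, (f a : ℝ) := by
  unfold wt
  simp_rw [h.grDim_eq]
  exact finsum_mul_card_fiber f fun m => (m : ℝ)

theorem IsAdapted.norm_sq_eq [Fintype ι] (h : F.IsAdapted e f) : F.norm ^ 2 = ∑ a, (f a : ℝ) ^ 2 := by
  have h1 : ∑ᶠ m : ℤ, (m : ℝ) ^ 2 * (F.grDim m : ℝ) = ∑ a, (f a : ℝ) ^ 2 := by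
    simp_rw [h.grDim_eq]
    exact finsum_mul_card_fiber f fun m => (m : ℝ) ^ 2
  unfold norm
  rw [h1, Real.sq_sqrt (Finset.sum_nonneg fun a _ => sq_nonneg _)]

theorem IsAdapted.eq_zero_of_isTrivial (h : F.IsAdapted e f) (hF : F.IsTrivial) (a : ι) :
    f a = 0 := by
  by_contra hne
  rcases lt_or_gt_of_ne hne with hlt | hgt
  · have h1 : e a ∈ F.part 0 := by rw [hF.1 0 le_rfl]; trivial
    rw [h 0] at h1
    have h2 := h1 a hlt
    simp at h2
  · have h1 : e a ∈ F.part (f a) := by rw [h]; exact e.self_mem_weightGE f le_rfl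
    rw [hF.2 _ hgt, Submodule.mem_bot] at h1
    exact e.ne_zero a h1

end AlgFiltration

end WeightedBasis

/-- An inequality that is linear in a large parameter. -/
theorem nonpos_of_forall_natCast_mul_le {x C N : ℝ} (h : ∀ n : ℕ, N ≤ n → n * x ≤ C) :
    x ≤ 0 := by
  by_contra hx
  push Not at hx
  obtain ⟨n, hn⟩ := exists_nat_gt (max N (C / x))
  have h1 := h n ((le_max_left _ _).trans hn.le)
  have h2 := (div_lt_iff₀ hx).1 ((le_max_right _ _).trans_lt hn)
  linarith

/-! ### A common basis for two filtrations -/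

section CommonBasis

variable {k : Type u} {V : Type v} [Field k] [AddCommGroup V] [Module k V]

/-- Two bounded decreasing filtrations of a finite-dimensional space are spanned by parts of a
common basis. -/
theorem exists_common_weighted_basis [FiniteDimensional k V] (F G : ℤ → Submodule k V)
    (hF : Antitone F) (hG : Antitone G)
    (hFt : ∃ N, ∀ i ≤ N, F i = ⊤) (hFb : ∃ N, ∀ i, N ≤ i → F i = ⊥)
    (hGt : ∃ N, ∀ i ≤ N, G i = ⊤) (hGb : ∃ N, ∀ i, N ≤ i → G i = ⊥) :
    ∃ (n : ℕ) (e : Module.Basis (Fin n) k V) (f g : Fin n → ℤ),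
      (∀ m, F m = e.weightGE f m) ∧ ∀ m, G m = e.weightGE g m := by
  classical
  obtain ⟨a, ha⟩ := hFt
  obtain ⟨b, hb⟩ := hFb
  obtain ⟨c, hc⟩ := hGt
  obtain ⟨d, hd⟩ := hGb
  -- `C (i, j)` represents the bigraded piece of `F` and `G`: a complement in `F i ⊓ G j` of the
  -- part that lies deeper in one of the two filtrations.
  have hC : ∀ p : ℤ × ℤ, ∃ C : Submodule k V,
      (F (p.1 + 1) ⊓ G p.2 ⊔ F p.1 ⊓ G (p.2 + 1)) ⊔ C = F p.1 ⊓ G p.2 ∧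
      Disjoint (F (p.1 + 1) ⊓ G p.2 ⊔ F p.1 ⊓ G (p.2 + 1)) C := by
    intro p
    have hle : F (p.1 + 1) ⊓ G p.2 ⊔ F p.1 ⊓ G (p.2 + 1) ≤ F p.1 ⊓ G p.2 :=
      sup_le (inf_le_inf_right _ (hF (by omega))) (inf_le_inf_left _ (hG (by omega)))
    obtain ⟨D, hD⟩ := exists_isCompl (F (p.1 + 1) ⊓ G p.2 ⊔ F p.1 ⊓ G (p.2 + 1))
    refine ⟨D ⊓ (F p.1 ⊓ G p.2), ?_, hD.disjoint.mono_right inf_le_left⟩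
    rw [← sup_inf_assoc_of_le _ hle, hD.sup_eq_top, top_inf_eq]
  choose C hCsup hCdisj using hC
  have hCF : ∀ p, C p ≤ F p.1 := fun p => (le_sup_right.trans (hCsup p).le).trans inf_le_left
  have hCG : ∀ p, C p ≤ G p.2 := fun p => (le_sup_right.trans (hCsup p).le).trans inf_le_right
  -- Induction on the distance to the indices `b` and `d` where the filtrations vanish.
  have hspan : ∀ (N : ℕ) (i j : ℤ), (b - i).toNat + (d - j).toNat ≤ N →
      F i ⊓ G j ≤ ⨆ p : ℤ × ℤ, ⨆ _ : i ≤ p.1 ∧ j ≤ p.2, C p := by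
    intro N
    induction N with
    | zero =>
      intro i j h
      rw [hb i (by omega), bot_inf_eq]
      exact bot_le
    | succ N ih =>
      intro i j h
      by_cases hi : b ≤ i
      · rw [hb i hi, bot_inf_eq]
        exact bot_le
      by_cases hj : d ≤ j
      · rw [hd j hj, inf_bot_eq]
        exact bot_le
      rw [← hCsup (i, j)]
      refine sup_le (sup_le ?_ ?_) ?_
      · refine (ih (i + 1) j (by omega)).trans (iSup₂_le fun p hp => ?_)
        exact le_iSup₂_of_le p ⟨by omega, hp.2⟩ le_rfl
      · refine (ih i (j + 1) (by omega)).trans (iSup₂_le fun p hp => ?_)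
        exact le_iSup₂_of_le p ⟨hp.1, by omega⟩ le_rfl
      · exact le_iSup₂_of_le (i, j) ⟨le_rfl, le_rfl⟩ le_rfl
  have hspan' : ∀ i j, F i ⊓ G j ≤ ⨆ p : ℤ × ℤ, ⨆ _ : i ≤ p.1 ∧ j ≤ p.2, C p :=
    fun i j => hspan _ i j le_rfl
  have hsup : iSup C = ⊤ := by
    rw [eq_top_iff]
    have h := hspan' a c
    rw [ha a le_rfl, hc c le_rfl, top_inf_eq] at h
    exact h.trans (iSup₂_le fun p _ => le_iSup C p)
  have hind : iSupIndep C := by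
    rw [iSupIndep_iff_finsetSum_eq_zero_imp_eq_zero]
    intro s v hv hv0
    by_contra hne
    push Not at hne
    obtain ⟨q, hq, hvq⟩ := hne
    -- In a relation, take the lexicographically first nonzero term. All other nonzero terms lie
    -- deeper in `F`, or equally deep in `F` and deeper in `G`.
    obtain ⟨p, hp, hmin⟩ := Finset.exists_min_image (s.filter fun p => v p ≠ 0) toLex
      ⟨q, Finset.mem_filter.2 ⟨hq, hvq⟩⟩
    rw [Finset.mem_filter] at hp
    have hlex : ∀ r ∈ s, v r ≠ 0 → p.1 < r.1 ∨ p.1 = r.1 ∧ p.2 ≤ r.2 := fun r hr hvr =>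
      Prod.Lex.le_iff.1 (hmin r (Finset.mem_filter.2 ⟨hr, hvr⟩))
    have hX : ∑ r ∈ (s.erase p).filter (fun r => p.1 < r.1), v r ∈ F (p.1 + 1) :=
      Submodule.sum_mem _ fun r hr => by
        rw [Finset.mem_filter, Finset.mem_erase] at hr
        exact hF (by have := hr.2; omega) (hCF r (hv r hr.1.2))
    have hY : ∑ r ∈ (s.erase p).filter (fun r => ¬ p.1 < r.1), v r ∈ F p.1 ⊓ G (p.2 + 1) :=
      Submodule.sum_mem _ fun r hr => by
        rw [Finset.mem_filter, Finset.mem_erase] at hr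
        by_cases hvr : v r = 0
        · rw [hvr]
          exact Submodule.zero_mem _
        rcases hlex r hr.1.2 hvr with h1 | ⟨h1, h2⟩
        · exact absurd h1 hr.2
        have h3 : p.2 ≠ r.2 := fun h3 => hr.1.1 (Prod.ext h1.symm h3.symm)
        exact ⟨hF h1.le (hCF r (hv r hr.1.2)), hG (by omega) (hCG r (hv r hr.1.2))⟩
    have hsum := hv0
    rw [← Finset.add_sum_erase s v hp.1,
      ← Finset.sum_filter_add_sum_filter_not (s.erase p) (fun r => p.1 < r.1)] at hsum
    set X := ∑ r ∈ (s.erase p).filter (fun r => p.1 < r.1), v r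
    set Y := ∑ r ∈ (s.erase p).filter (fun r => ¬ p.1 < r.1), v r
    have hvp : v p = -X - Y := by
      rw [← sub_eq_zero, ← hsum]
      abel
    -- The terms of `X` need not lie in `G p.2` individually, but the relation forces their sum to.
    have hXG : X ∈ G p.2 := by
      have hX' : X = -(v p) - Y := by rw [hvp]; abel
      rw [hX']
      exact Submodule.sub_mem _ (Submodule.neg_mem _ (hCG p (hv p hp.1))) (hG (by omega) hY.2)
    refine hp.2 ((Submodule.disjoint_def.1 (hCdisj p)) _ ?_ (hv p hp.1))
    rw [hvp]
    exact Submodule.sub_mem _ (Submodule.neg_mem _ (Submodule.mem_sup_left ⟨hX, hXG⟩))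
      (Submodule.mem_sup_right hY)
  have hint : DirectSum.IsInternal C :=
    DirectSum.isInternal_submodule_of_iSupIndep_of_iSup_eq_top hind hsup
  let B := hint.collectedBasis fun p => Module.finBasis k (C p)
  have : Finite (Σ p, Fin (Module.finrank k (C p))) := Module.Finite.finite_basis B
  have := Fintype.ofFinite (Σ p, Fin (Module.finrank k (C p)))
  let σ := Fintype.equivFin (Σ p, Fin (Module.finrank k (C p)))
  let e := B.reindex σ
  have he : ∀ x : Fin _, e x ∈ C (σ.symm x).1 := by
    intro x
    simp only [e, Module.Basis.reindex_apply]
    exact hint.collectedBasis_mem _ _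
  have hCe : ∀ p, C p ≤ Submodule.span k (e '' {x | (σ.symm x).1 = p}) := by
    intro p y hy
    have h1 := congrArg (Submodule.subtype (C p))
      ((Module.finBasis k (C p)).sum_repr ⟨y, hy⟩)
    rw [map_sum] at h1
    simp only [Submodule.subtype_apply] at h1
    rw [← h1]
    refine Submodule.sum_mem _ fun t _ => ?_
    refine Submodule.smul_mem _ _ (Submodule.subset_span ⟨σ ⟨p, t⟩, by simp, ?_⟩)
    rw [Module.Basis.reindex_apply, σ.symm_apply_apply, hint.collectedBasis_coe]
  refine ⟨_, e, fun x => (σ.symm x).1.1, fun x => (σ.symm x).1.2, fun m => ?_, fun m => ?_⟩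
  · rw [e.weightGE_eq_span]
    refine le_antisymm ?_ (Submodule.span_le.2 ?_)
    · have h := hspan' m c
      rw [hc c le_rfl, inf_top_eq] at h
      refine h.trans (iSup₂_le fun p hp => (hCe p).trans (Submodule.span_mono ?_))
      rintro _ ⟨x, hx, rfl⟩
      exact ⟨x, by rw [Set.mem_ofPred_eq] at hx ⊢; rw [hx]; exact hp.1, rfl⟩
    · rintro _ ⟨x, hx, rfl⟩
      exact hF hx (hCF _ (he x))
  · rw [e.weightGE_eq_span]
    refine le_antisymm ?_ (Submodule.span_le.2 ?_)
    · have h := hspan' a m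
      rw [ha a le_rfl, top_inf_eq] at h
      refine h.trans (iSup₂_le fun p hp => (hCe p).trans (Submodule.span_mono ?_))
      rintro _ ⟨x, hx, rfl⟩
      exact ⟨x, by rw [Set.mem_ofPred_eq] at hx ⊢; rw [hx]; exact hp.2, rfl⟩
    · rintro _ ⟨x, hx, rfl⟩
      exact hG hx (hCG _ (he x))

end CommonBasis

/-! ### Decompositions given by orthogonal idempotents -/

section ProjectionFamily

variable {k : Type u} {V : Type v} [Field k] [AddCommGroup V] [Module k V]

/-- A family of orthogonal idempotents whose members over the finite set `S` sum to one. -/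
structure IsProjFamily {κ : Type*} (S : Finset κ) (p : κ → Module.End k V) : Prop where
  mul_self : ∀ i, p i * p i = p i
  mul_of_ne : ∀ i j, i ≠ j → p i * p j = 0
  sum_eq : ∑ i ∈ S, p i = 1

namespace IsProjFamily

variable {κ : Type*} {S : Finset κ} {p : κ → Module.End k V}

theorem apply_self (h : IsProjFamily S p) (i : κ) (x : V) : p i (p i x) = p i x :=
  LinearMap.congr_fun (h.mul_self i) x

theorem apply_of_ne (h : IsProjFamily S p) {i j : κ} (hij : i ≠ j) (x : V) : p i (p j x) = 0 :=
  LinearMap.congr_fun (h.mul_of_ne i j hij) x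

theorem sum_apply (h : IsProjFamily S p) (x : V) : ∑ i ∈ S, p i x = x := by
  have h1 := LinearMap.congr_fun h.sum_eq x
  rwa [LinearMap.sum_apply] at h1

theorem isInternal [DecidableEq κ] (h : IsProjFamily S p) :
    DirectSum.IsInternal fun i => LinearMap.range (p i) := by
  refine DirectSum.isInternal_submodule_of_iSupIndep_of_iSup_eq_top ?_ ?_
  · rw [iSupIndep_iff_finsetSum_eq_zero_imp_eq_zero]
    intro s v hv hv0 i hi
    have h1 := congrArg (p i) hv0
    rw [map_sum, map_zero, Finset.sum_eq_single_of_mem i hi] at h1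
    · obtain ⟨y, hy⟩ := hv i hi
      rwa [← hy, h.apply_self, hy] at h1
    · intro j hj hji
      obtain ⟨y, hy⟩ := hv j hj
      rw [← hy, h.apply_of_ne hji.symm]
  · rw [eq_top_iff]
    intro x _
    rw [← h.sum_apply x]
    exact Submodule.sum_mem _ fun i _ => Submodule.mem_iSup_of_mem i ⟨x, rfl⟩

end IsProjFamily

end ProjectionFamily

/-! ### Gradings through their projections -/

namespace GradingOperator

variable {k : Type u} {V : Type v} [Field k] [AddCommGroup V] [Module k V]
  {μ : V →ₗ[k] V →ₗ[k] V}

theorem proj_mem (φ : GradingOperator μ) (i : ℤ) (x : V) : φ.proj i x ∈ φ.piece i :=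
  Subtype.property _

theorem proj_of_mem (φ : GradingOperator μ) {i : ℤ} {x : V} (hx : x ∈ φ.piece i) :
    φ.proj i x = x :=
  congrArg Subtype.val (φ.isInternal.ofBijective_coeLinearMap_of_mem hx)

theorem proj_of_mem_ne (φ : GradingOperator μ) {i j : ℤ} (hij : i ≠ j) {x : V}
    (hx : x ∈ φ.piece i) : φ.proj j x = 0 :=
  congrArg Subtype.val (φ.isInternal.ofBijective_coeLinearMap_of_mem_ne hij hx)

theorem mem_piece_iff (φ : GradingOperator μ) {i : ℤ} {x : V} :
    x ∈ φ.piece i ↔ φ.proj i x = x :=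
  ⟨φ.proj_of_mem, fun h => h ▸ φ.proj_mem i x⟩

/-- The grading operator given by a multiplicative family of projections. -/
def ofProj {S : Finset ℤ} {p : ℤ → Module.End k V} (h : IsProjFamily S p)
    (hmul : ∀ i j x y, p (i + j) (μ (p i x) (p j y)) = μ (p i x) (p j y)) :
    GradingOperator μ where
  piece i := LinearMap.range (p i)
  isInternal := h.isInternal
  mul_mem := by
    rintro i j _ _ ⟨x, rfl⟩ ⟨y, rfl⟩
    exact ⟨_, hmul i j x y⟩

theorem proj_ofProj {S : Finset ℤ} {p : ℤ → Module.End k V} (h : IsProjFamily S p)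
    (hmul : ∀ i j x y, p (i + j) (μ (p i x) (p j y)) = μ (p i x) (p j y)) (i : ℤ) :
    (ofProj h hmul).proj i = p i := by
  refine LinearMap.ext fun x => ?_
  have hmem : ∀ j, p j x ∈ (ofProj h hmul).piece j := fun j => ⟨x, rfl⟩
  rw [← h.sum_apply x, map_sum, map_sum]
  refine Finset.sum_congr rfl fun j _ => ?_
  by_cases hij : j = i
  · subst hij
    rw [proj_of_mem _ (hmem j), h.apply_self]
  · rw [proj_of_mem_ne _ hij (hmem j), h.apply_of_ne (Ne.symm hij)]

variable [FiniteDimensional k V]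

/-- The degrees in which the grading is nonzero. -/
noncomputable def supp (φ : GradingOperator μ) : Finset ℤ := φ.finite_support.toFinset

theorem isProjFamily (φ : GradingOperator μ) : IsProjFamily φ.supp φ.proj where
  mul_self i := LinearMap.ext fun x => φ.proj_of_mem (φ.proj_mem i x)
  mul_of_ne i j hij := LinearMap.ext fun x => φ.proj_of_mem_ne hij.symm (φ.proj_mem j x)
  sum_eq := by
    refine LinearMap.ext fun x => ?_
    have hx : x ∈ ⨆ i, φ.piece i := by
      rw [φ.isInternal.submodule_iSup_eq_top]
      trivial
    refine Submodule.iSup_induction φ.piece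
      (motive := fun x => (∑ i ∈ φ.supp, φ.proj i) x = (1 : Module.End k V) x) hx ?_ ?_ ?_
    · intro i x hx
      rw [LinearMap.sum_apply, Module.End.one_apply]
      by_cases hi : φ.piece i = ⊥
      · rw [hi, Submodule.mem_bot] at hx
        simp [hx]
      · rw [Finset.sum_eq_single_of_mem i (by simpa [supp] using hi), φ.proj_of_mem hx]
        intro j _ hji
        exact φ.proj_of_mem_ne hji.symm hx
    · simp
    · intro x y hx hy
      rw [map_add, map_add, hx, hy]

theorem mem_splitFiltration (φ : GradingOperator μ) {m : ℤ} {x : V} :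
    x ∈ φ.splitFiltration.part m ↔ ∀ d < m, φ.proj d x = 0 := by
  constructor
  · intro hx d hd
    have h1 : (⨆ e : ℤ, ⨆ _ : m ≤ e, φ.piece e) ≤ LinearMap.ker (φ.proj d) :=
      iSup₂_le fun e he y hy => φ.proj_of_mem_ne (by omega) hy
    exact h1 hx
  · intro h
    rw [← φ.isProjFamily.sum_apply x]
    refine Submodule.sum_mem _ fun d _ => ?_
    rcases lt_or_ge d m with hd | hd
    · rw [h d hd]
      exact Submodule.zero_mem _
    · exact (le_iSup₂_of_le (f := fun e (_ : m ≤ e) => φ.piece e) d hd le_rfl) (φ.proj_mem d x)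

theorem proj_mul (φ : GradingOperator μ) (d : ℤ) (x y : V) :
    φ.proj d (μ x y) = ∑ i ∈ φ.supp, ∑ j ∈ φ.supp,
      if i + j = d then μ (φ.proj i x) (φ.proj j y) else 0 := by
  conv_lhs => rw [← φ.isProjFamily.sum_apply x, ← φ.isProjFamily.sum_apply y]
  simp only [map_sum, LinearMap.sum_apply]
  rw [Finset.sum_comm]
  refine Finset.sum_congr rfl fun i _ => Finset.sum_congr rfl fun j _ => ?_
  have h1 := φ.mul_mem i j _ _ (φ.proj_mem i x) (φ.proj_mem j y)
  split_ifs with h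
  · subst h
    exact φ.proj_of_mem h1
  · exact φ.proj_of_mem_ne h h1

theorem proj_eq_zero_of_notMem_supp (φ : GradingOperator μ) {i : ℤ} (hi : i ∉ φ.supp) (x : V) :
    φ.proj i x = 0 := by
  have h := φ.proj_mem i x
  have h1 : φ.piece i = ⊥ := by
    by_contra hne
    exact hi (by simpa [supp] using hne)
  rwa [h1, Submodule.mem_bot] at h

/-- The leading part of a product is the product of the leading parts. -/
theorem proj_add_mul (φ : GradingOperator μ) {i j : ℤ} {x y : V}
    (hx : ∀ d < i, φ.proj d x = 0) (hy : ∀ d < j, φ.proj d y = 0) :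
    φ.proj (i + j) (μ x y) = μ (φ.proj i x) (φ.proj j y) := by
  have hzero : ∀ a b, a + b = i + j → ¬ (a = i ∧ b = j) →
      μ (φ.proj a x) (φ.proj b y) = 0 := by
    intro a b hab hne
    rcases lt_or_ge a i with ha | ha
    · rw [hx a ha, map_zero, LinearMap.zero_apply]
    · rw [hy b (by omega), map_zero]
  rw [proj_mul, Finset.sum_eq_single i, Finset.sum_eq_single j]
  · rw [if_pos rfl]
  · intro b _ hb
    split_ifs with h
    · exact hzero _ _ h (by tauto)
    · rfl
  · intro hj
    rw [φ.proj_eq_zero_of_notMem_supp hj]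
    simp
  · intro a _ ha
    refine Finset.sum_eq_zero fun b _ => ?_
    split_ifs with h
    · exact hzero _ _ h (by tauto)
    · rfl
  · intro hi
    rw [φ.proj_eq_zero_of_notMem_supp hi]
    simp

/-- A product of a factor of degrees below `i` and a factor of degrees at most `j` has degrees below
`i + j`. -/
theorem proj_mul_eq_zero_of_ge (φ : GradingOperator μ) {i j d : ℤ} {x y : V}
    (hx : ∀ e, i ≤ e → φ.proj e x = 0) (hy : ∀ e, j < e → φ.proj e y = 0) (hd : i + j ≤ d) :
    φ.proj d (μ x y) = 0 := by
  rw [proj_mul]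
  refine Finset.sum_eq_zero fun a _ => Finset.sum_eq_zero fun b _ => ?_
  split_ifs with h
  · rcases lt_or_ge a i with ha | ha
    · rw [hy b (by omega), map_zero]
    · rw [hx a ha, map_zero, LinearMap.zero_apply]
  · rfl

/-- A product of a factor of degrees at most `i` and a factor of degrees below `j` has degrees below
`i + j`. -/
theorem proj_mul_eq_zero_of_ge' (φ : GradingOperator μ) {i j d : ℤ} {x y : V}
    (hx : ∀ e, i < e → φ.proj e x = 0) (hy : ∀ e, j ≤ e → φ.proj e y = 0) (hd : i + j ≤ d) :
    φ.proj d (μ x y) = 0 := by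
  rw [proj_mul]
  refine Finset.sum_eq_zero fun a _ => Finset.sum_eq_zero fun b _ => ?_
  split_ifs with h
  · rcases lt_or_ge b j with hb | hb
    · rw [hx a (by omega), map_zero, LinearMap.zero_apply]
    · rw [hy b hb, map_zero]
  · rfl

end GradingOperator

/-! ### Endomorphisms that preserve or shift a filtration -/

namespace AlgFiltration

variable {k : Type u} {V : Type v} [Field k] [AddCommGroup V] [Module k V]
  {μ : V →ₗ[k] V →ₗ[k] V}

/-- The endomorphisms that preserve every step of the filtration. -/
def stabilizer (F : AlgFiltration μ) : Subalgebra k (Module.End k V) where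
  carrier := {h | ∀ m x, x ∈ F.part m → h x ∈ F.part m}
  mul_mem' ha hb m x hx := ha m _ (hb m x hx)
  add_mem' ha hb m x hx := Submodule.add_mem _ (ha m x hx) (hb m x hx)
  algebraMap_mem' c m x hx := by
    rw [Module.algebraMap_end_apply]
    exact Submodule.smul_mem _ c hx

/-- The endomorphisms that shift the filtration by one. -/
def shifting (F : AlgFiltration μ) : Submodule k (Module.End k V) where
  carrier := {h | ∀ m x, x ∈ F.part m → h x ∈ F.part (m + 1)}
  add_mem' ha hb m x hx := Submodule.add_mem _ (ha m x hx) (hb m x hx)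
  zero_mem' _ _ _ := Submodule.zero_mem _
  smul_mem' c _ ha m x hx := Submodule.smul_mem _ c (ha m x hx)

theorem mul_mem_shifting_left {F : AlgFiltration μ} {g h : Module.End k V}
    (hg : g ∈ F.stabilizer) (hh : h ∈ F.shifting) : g * h ∈ F.shifting :=
  fun m x hx => hg (m + 1) _ (hh m x hx)

theorem mul_mem_shifting_right {F : AlgFiltration μ} {g h : Module.End k V}
    (hg : g ∈ F.shifting) (hh : h ∈ F.stabilizer) : g * h ∈ F.shifting :=
  fun m x hx => hg m _ (hh m x hx)

/-- The vector climbs from a step equal to `⊤` to a step equal to `⊥`. -/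
theorem eq_zero_of_forall_mem_succ (F : AlgFiltration μ) {x : V}
    (h : ∀ m, x ∈ F.part m → x ∈ F.part (m + 1)) : x = 0 := by
  obtain ⟨a, ha⟩ := F.eventually_top
  obtain ⟨b, hb⟩ := F.eventually_bot
  have h1 : ∀ n : ℕ, x ∈ F.part (a + n) := by
    intro n
    induction n with
    | zero =>
      rw [ha _ (by simp)]
      trivial
    | succ n ih =>
      have := h _ ih
      rwa [Nat.cast_succ, ← add_assoc]
  have h2 := h1 (b - a).toNat
  rwa [hb _ (by omega), Submodule.mem_bot] at h2

variable [FiniteDimensional k V]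

/-- An endomorphism congruent to the identity modulo a shift of the filtration is invertible, and
so is congruent to the identity its inverse. -/
theorem exists_unit_of_sub_one_mem_shifting {F : AlgFiltration μ} {h : Module.End k V}
    (hh : h - 1 ∈ F.shifting) :
    ∃ w : (Module.End k V)ˣ, (w : Module.End k V) = h ∧
      ((w⁻¹ : (Module.End k V)ˣ) : Module.End k V) - 1 ∈ F.shifting ∧
      ((w⁻¹ : (Module.End k V)ˣ) : Module.End k V) ∈ F.stabilizer := by
  have hunit : IsUnit h := by
    rw [LinearMap.isUnit_iff_ker_eq_bot, LinearMap.ker_eq_bot']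
    intro x hx
    refine F.eq_zero_of_forall_mem_succ fun m hm => ?_
    have h1 := hh m x hm
    rw [LinearMap.sub_apply, hx, Module.End.one_apply, zero_sub] at h1
    exact neg_mem_iff.1 h1
  obtain ⟨w, rfl⟩ := hunit
  have hstab : ((w⁻¹ : (Module.End k V)ˣ) : Module.End k V) ∈ F.stabilizer := by
    intro m x hx
    set y := ((w⁻¹ : (Module.End k V)ˣ) : Module.End k V) x with hy
    have hwy : (w : Module.End k V) y = x := by
      rw [hy, ← Module.End.mul_apply, Units.mul_inv, Module.End.one_apply]
    obtain ⟨a, ha⟩ := F.eventually_top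
    -- From `y = x - (w - 1) y`, each step gains one degree for `y` until the degree `m` of `x` is
    -- reached.
    have h1 : ∀ n : ℕ, a + n ≤ m → y ∈ F.part (a + n) := by
      intro n
      induction n with
      | zero =>
        intro _
        rw [ha _ (by simp)]
        trivial
      | succ n ih =>
        intro hn
        have h2 := hh _ y (ih (by omega))
        rw [LinearMap.sub_apply, hwy, Module.End.one_apply] at h2
        have h3 : y = x - (x - y) := by abel
        rw [h3]
        refine Submodule.sub_mem _ (F.anti _ _ hn hx) ?_
        rwa [Nat.cast_succ, ← add_assoc]
    rcases le_or_gt m a with hma | hma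
    · rw [ha m hma]
      trivial
    · have h2 := h1 (m - a).toNat (by omega)
      rwa [show a + ((m - a).toNat : ℤ) = m by omega] at h2
  refine ⟨w, rfl, ?_, hstab⟩
  have h1 : ((w⁻¹ : (Module.End k V)ˣ) : Module.End k V) - 1
      = -(((w⁻¹ : (Module.End k V)ˣ) : Module.End k V) * ((w : Module.End k V) - 1)) := by
    rw [mul_sub, Units.inv_mul]
    noncomm_ring
  rw [h1]
  exact Submodule.neg_mem _ (mul_mem_shifting_left hstab hh)

end AlgFiltration

namespace AlgFiltration

variable {k : Type u} {V : Type v} [Field k] [AddCommGroup V] [Module k V]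
  {μ : V →ₗ[k] V →ₗ[k] V}

theorem eq_of_part_eq {F G : AlgFiltration μ} (h : F.part = G.part) : F = G := by
  cases F
  cases G
  cases h
  rfl

theorem mem_stabilizer_of_mem_shifting {F : AlgFiltration μ} {h : Module.End k V}
    (hh : h ∈ F.shifting) : h ∈ F.stabilizer :=
  fun m x hx => F.anti m (m + 1) (by omega) (hh m x hx)

end AlgFiltration

/-! ### Conjugating gradings and moving splittings -/

namespace GradingOperator

variable {k : Type u} {V : Type v} [Field k] [AddCommGroup V] [Module k V]
  {μ : V →ₗ[k] V →ₗ[k] V} [FiniteDimensional k V]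

theorem ext_proj (φ : GradingOperator μ) {x y : V} (h : ∀ i, φ.proj i x = φ.proj i y) : x = y := by
  rw [← φ.isProjFamily.sum_apply x, ← φ.isProjFamily.sum_apply y]
  exact Finset.sum_congr rfl fun i _ => h i

/-- The projection onto the components of degree at least `i`. -/
noncomputable def tail (φ : GradingOperator μ) (i : ℤ) : Module.End k V :=
  ∑ j ∈ φ.supp.filter (i ≤ ·), φ.proj j

theorem proj_tail (φ : GradingOperator μ) (i d : ℤ) (x : V) :
    φ.proj d (φ.tail i x) = if i ≤ d then φ.proj d x else 0 := by
  rw [tail, LinearMap.sum_apply, map_sum]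
  by_cases hd : d ∈ φ.supp.filter (i ≤ ·)
  · rw [Finset.sum_eq_single_of_mem d hd, φ.isProjFamily.apply_self,
      if_pos (Finset.mem_filter.1 hd).2]
    exact fun j _ hj => φ.isProjFamily.apply_of_ne hj.symm x
  · rw [Finset.sum_eq_zero fun j hj => φ.isProjFamily.apply_of_ne
      (by rintro rfl; exact hd hj) x]
    split_ifs with h
    · rw [φ.proj_eq_zero_of_notMem_supp fun hs => hd (Finset.mem_filter.2 ⟨hs, h⟩)]
    · rfl

theorem proj_mul_tail (φ : GradingOperator μ) (i : ℤ) : φ.proj i * φ.tail i = φ.proj i :=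
  LinearMap.ext fun x => by rw [Module.End.mul_apply, proj_tail, if_pos le_rfl]

/-- Two algebra gradings that preserve a filtration and agree on its associated graded algebra are
conjugate under an automorphism of the filtered algebra. -/
theorem exists_automorphism_of_sub_mem_shifting {F : AlgFiltration μ} {φ φ' : GradingOperator μ}
    (hφ : ∀ i, φ.proj i ∈ F.stabilizer) (hφ' : ∀ i, φ'.proj i ∈ F.stabilizer)
    (hc : ∀ i, φ.proj i - φ'.proj i ∈ F.shifting) :
    ∃ g : (Module.End k V)ˣ,
      (∀ x y, (g : Module.End k V) (μ x y) = μ ((g : Module.End k V) x) ((g : Module.End k V) y)) ∧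
      (∀ i, φ.proj i * g = g * φ'.proj i) ∧
      (g : Module.End k V) ∈ F.stabilizer ∧
      ((g⁻¹ : (Module.End k V)ˣ) : Module.End k V) ∈ F.stabilizer ∧
      ∀ θ : Module.End k V, (∀ i, Commute θ (φ.proj i)) → (∀ i, Commute θ (φ'.proj i)) →
        Commute θ (g : Module.End k V) := by
  have htail : ∀ i, φ.tail i ∈ F.stabilizer := fun i => Subalgebra.sum_mem _ fun j _ => hφ j
  have hdiff : ∀ i, φ.tail i - φ'.tail i ∈ F.shifting := by
    intro i
    have h1 : ∀ (χ : GradingOperator μ) (S : Finset ℤ), χ.supp ⊆ S →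
        χ.tail i = ∑ j ∈ S.filter (i ≤ ·), χ.proj j := by
      intro χ S hS
      refine Finset.sum_subset (Finset.filter_subset_filter _ hS) fun j hj hj' => ?_
      refine LinearMap.ext fun x => χ.proj_eq_zero_of_notMem_supp (fun hs => hj' ?_) x
      exact Finset.mem_filter.2 ⟨hs, (Finset.mem_filter.1 hj).2⟩
    rw [h1 φ (φ.supp ∪ φ'.supp) Finset.subset_union_left,
      h1 φ' (φ.supp ∪ φ'.supp) Finset.subset_union_right, ← Finset.sum_sub_distrib]
    exact Submodule.sum_mem _ fun j _ => hc j
  -- This endomorphism sends `y` to the sum of a vector of `φ`-degrees at least `i` and one of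
  -- `φ'`-degrees below `i`. Its invertibility gives a decomposition of the space into these two
  -- parts.
  have hw : ∀ i, φ.tail i + (1 - φ'.tail i) - 1 ∈ F.shifting := by
    intro i
    have h1 : φ.tail i + (1 - φ'.tail i) - 1 = φ.tail i - φ'.tail i := by abel
    rw [h1]
    exact hdiff i
  choose w hw1 hw2 _hw3 using fun i => AlgFiltration.exists_unit_of_sub_one_mem_shifting (hw i)
  -- `r i` is the projection onto the part of `φ`-degrees at least `i` along the part of
  -- `φ'`-degrees below `i`.
  set r : ℤ → Module.End k V := fun i => φ.tail i * ((w i)⁻¹ : (Module.End k V)ˣ) with hr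
  have hr1 : ∀ i x d, d < i → φ.proj d (r i x) = 0 := by
    intro i x d hd
    rw [hr, Module.End.mul_apply, proj_tail, if_neg (by omega)]
  have hr2 : ∀ i x d, i ≤ d → φ'.proj d (x - r i x) = 0 := by
    intro i x d hd
    set y := (((w i)⁻¹ : (Module.End k V)ˣ) : Module.End k V) x with hy
    have h1 : x = φ.tail i y + (y - φ'.tail i y) := by
      have h2 : ((w i : (Module.End k V)ˣ) : Module.End k V) y = x := by
        rw [hy, ← Module.End.mul_apply, Units.mul_inv, Module.End.one_apply]
      rw [hw1] at h2
      exact h2.symm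
    have h3 : x - r i x = y - φ'.tail i y := by
      have h4 : r i x = φ.tail i y := rfl
      rw [h4]
      nth_rewrite 1 [h1]
      abel
    rw [h3, map_sub, proj_tail, if_pos hd, sub_self]
  -- The two parts meet in zero: on such `z` the two tails are `z` and `0`, and their difference
  -- shifts `F`.
  have huniq : ∀ i z, (∀ d < i, φ.proj d z = 0) → (∀ d, i ≤ d → φ'.proj d z = 0) → z = 0 := by
    intro i z h1 h2
    refine F.eq_zero_of_forall_mem_succ fun m hm => ?_
    have h3 : φ.tail i z = z := by
      refine φ.ext_proj fun d => ?_
      rw [proj_tail]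
      split_ifs with h
      · rfl
      · rw [h1 d (by omega)]
    have h4 : φ'.tail i z = 0 := by
      refine φ'.ext_proj fun d => ?_
      rw [proj_tail, map_zero]
      split_ifs with h
      · exact h2 d h
      · rfl
    have h5 := hdiff i m z hm
    rwa [LinearMap.sub_apply, h3, h4, sub_zero] at h5
  -- On a vector of `φ'`-degree `i`, correct it by lower `φ'`-degrees until its `φ`-degrees are at
  -- least `i`, then take the leading `φ`-component.
  set G : Module.End k V := ∑ i ∈ φ'.supp, φ.proj i * (r i * φ'.proj i) with hG
  have hG1 : G - 1 ∈ F.shifting := by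
    rw [← φ'.isProjFamily.sum_eq, hG, ← Finset.sum_sub_distrib]
    refine Submodule.sum_mem _ fun i _ => ?_
    have h1 : r i - φ.tail i ∈ F.shifting := by
      have h2 : r i - φ.tail i = φ.tail i * (((w i)⁻¹ : (Module.End k V)ˣ) - 1) := by
        rw [hr, mul_sub, mul_one]
      rw [h2]
      exact AlgFiltration.mul_mem_shifting_left (htail i) (hw2 i)
    have h2 : φ.proj i * (r i * φ'.proj i) - φ'.proj i
        = φ.proj i * ((r i - φ.tail i) * φ'.proj i) + (φ.proj i - φ'.proj i) * φ'.proj i := by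
      rw [sub_mul (r i), mul_sub (φ.proj i), ← mul_assoc (φ.proj i) (φ.tail i), proj_mul_tail,
        sub_mul (φ.proj i), φ'.isProjFamily.mul_self]
      abel
    rw [h2]
    exact Submodule.add_mem _
      (AlgFiltration.mul_mem_shifting_left (hφ i)
        (AlgFiltration.mul_mem_shifting_right h1 (hφ' i)))
      (AlgFiltration.mul_mem_shifting_right (hc i) (hφ' i))
  have hGstab : G ∈ F.stabilizer := by
    have h1 : G = (G - 1) + 1 := by abel
    rw [h1]
    exact Subalgebra.add_mem _ (AlgFiltration.mem_stabilizer_of_mem_shifting hG1)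
      (Subalgebra.one_mem _)
  obtain ⟨g, hg1, -, hg3⟩ := AlgFiltration.exists_unit_of_sub_one_mem_shifting hG1
  have hzero : ∀ i, i ∉ φ'.supp → φ'.proj i = 0 := fun i hi =>
    LinearMap.ext fun x => φ'.proj_eq_zero_of_notMem_supp hi x
  have hleft : ∀ i, φ.proj i * G = φ.proj i * (r i * φ'.proj i) := by
    intro i
    rw [hG, Finset.mul_sum, Finset.sum_eq_single i]
    · rw [← mul_assoc, φ.isProjFamily.mul_self]
    · intro j _ hj
      rw [← mul_assoc, φ.isProjFamily.mul_of_ne i j hj.symm, zero_mul]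
    · intro hi
      rw [hzero i hi, mul_zero, mul_zero, mul_zero]
  have hright : ∀ i, G * φ'.proj i = φ.proj i * (r i * φ'.proj i) := by
    intro i
    rw [hG, Finset.sum_mul, Finset.sum_eq_single i]
    · rw [mul_assoc, mul_assoc, φ'.isProjFamily.mul_self]
    · intro j _ hj
      rw [mul_assoc, mul_assoc, φ'.isProjFamily.mul_of_ne j i hj, mul_zero, mul_zero]
    · intro hi
      rw [hzero i hi, mul_zero]
  have hGpiece : ∀ i x, x ∈ φ'.piece i → G x = φ.proj i (r i x) := by
    intro i x hx
    have h1 := LinearMap.congr_fun (hright i) x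
    simpa only [Module.End.mul_apply, φ'.proj_of_mem hx] using h1
  have hmulpiece : ∀ i j x y, x ∈ φ'.piece i → y ∈ φ'.piece j → G (μ x y) = μ (G x) (G y) := by
    intro i j x y hx hy
    have hxgt : ∀ e, i < e → φ'.proj e x = 0 := fun e he => φ'.proj_of_mem_ne he.ne hx
    have hygt : ∀ e, j < e → φ'.proj e y = 0 := fun e he => φ'.proj_of_mem_ne he.ne hy
    -- `r` is multiplicative on homogeneous vectors: the difference has `φ`-degrees at least `i + j`
    -- and `φ'`-degrees below `i + j`, so it vanishes. Leading components then turn this into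
    -- multiplicativity of `G`.
    have key : r (i + j) (μ x y) - μ (r i x) (r j y) = 0 := by
      refine huniq (i + j) _ (fun d hd => ?_) fun d hd => ?_
      · have h1 := φ.splitFiltration.mul_mem i j (r i x) (r j y)
          (φ.mem_splitFiltration.2 (hr1 i x)) (φ.mem_splitFiltration.2 (hr1 j y))
        rw [map_sub, hr1 _ _ d hd, φ.mem_splitFiltration.1 h1 d hd, sub_zero]
      · have h1 : r (i + j) (μ x y) - μ (r i x) (r j y)
            = μ x (y - r j y) + μ (x - r i x) (r j y) - (μ x y - r (i + j) (μ x y)) := by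
          simp only [map_sub, LinearMap.sub_apply]
          abel
        have h2 : ∀ e, j < e → φ'.proj e (r j y) = 0 := by
          intro e he
          have h3 : r j y = y - (y - r j y) := by abel
          rw [h3, map_sub, hygt e he, hr2 j y e he.le, sub_zero]
        rw [h1, map_sub, map_add, hr2 _ _ d hd,
          φ'.proj_mul_eq_zero_of_ge' hxgt (hr2 j y) hd,
          φ'.proj_mul_eq_zero_of_ge (hr2 i x) h2 hd, add_zero, sub_zero]
    rw [hGpiece _ _ (φ'.mul_mem i j x y hx hy), sub_eq_zero.1 key,
      φ.proj_add_mul (hr1 i x) (hr1 j y), hGpiece i x hx, hGpiece j y hy]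
  refine ⟨g, ?_, ?_, ?_, hg3, ?_⟩
  · intro x y
    rw [hg1, ← φ'.isProjFamily.sum_apply x, ← φ'.isProjFamily.sum_apply y]
    simp only [map_sum, LinearMap.sum_apply]
    exact Finset.sum_congr rfl fun i _ => Finset.sum_congr rfl fun j _ =>
      hmulpiece _ _ _ _ (φ'.proj_mem _ x) (φ'.proj_mem _ y)
  · intro i
    rw [hg1, hleft, hright]
  · rw [hg1]
    exact hGstab
  · intro θ h1 h2
    have ht : ∀ i, Commute θ (φ.tail i) := fun i => Commute.sum_right _ _ _ fun j _ => h1 j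
    have ht' : ∀ i, Commute θ (φ'.tail i) := fun i => Commute.sum_right _ _ _ fun j _ => h2 j
    have hwc : ∀ i, Commute θ (((w i)⁻¹ : (Module.End k V)ˣ) : Module.End k V) := by
      intro i
      refine Commute.units_inv_right ?_
      rw [hw1]
      exact (ht i).add_right ((Commute.one_right θ).sub_right (ht' i))
    rw [hg1, hG]
    exact Commute.sum_right _ _ _ fun i _ =>
      (h1 i).mul_right (((ht i).mul_right (hwc i)).mul_right (h2 i))

/-- A grading that preserves the split filtration of the grading `A` agrees on the associated
graded algebra with a grading that commutes with `A`. -/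
theorem exists_commuting_associate (A φ : GradingOperator μ)
    (hφ : ∀ i, φ.proj i ∈ A.splitFiltration.stabilizer) :
    ∃ φ' : GradingOperator μ, A.Commutes φ' ∧
      (∀ i, φ.proj i - φ'.proj i ∈ A.splitFiltration.shifting) ∧
      ∀ θ : Module.End k V, (∀ i, Commute θ (A.proj i)) → (∀ i, Commute θ (φ.proj i)) →
        ∀ i, Commute θ (φ'.proj i) := by
  have hA := A.isProjFamily
  have hmem : ∀ m x, A.proj m x ∈ A.splitFiltration.part m := fun m x =>
    A.mem_splitFiltration.2 fun d hd => hA.apply_of_ne hd.ne x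
  -- Modulo `F (m + 1)`, the image under `φ.proj i` of a vector of `F m` depends only on its
  -- component of degree `m`.
  have hlead : ∀ i m x, x ∈ A.splitFiltration.part m →
      A.proj m (φ.proj i (A.proj m x)) = A.proj m (φ.proj i x) := by
    intro i m x hx
    have h1 : x - A.proj m x ∈ A.splitFiltration.part (m + 1) := by
      rw [mem_splitFiltration] at hx ⊢
      intro d hd
      rw [map_sub]
      rcases eq_or_ne d m with rfl | hne
      · rw [hA.apply_self, sub_self]
      · rw [hx d (by omega), hA.apply_of_ne hne, sub_zero]
    have h2 := A.mem_splitFiltration.1 (hφ i _ _ h1) m (by omega)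
    rw [map_sub, map_sub, sub_eq_zero] at h2
    exact h2.symm
  -- `φ.proj i` is block triangular for the grading `A`, and `q i` is its block diagonal part.
  set q : ℤ → Module.End k V := fun i => ∑ m ∈ A.supp, A.proj m * (φ.proj i * A.proj m) with hq
  have hqA : ∀ i m x, A.proj m (q i x) = A.proj m (φ.proj i (A.proj m x)) := by
    intro i m x
    simp only [hq, LinearMap.sum_apply, map_sum, Module.End.mul_apply]
    rw [Finset.sum_eq_single m]
    · rw [hA.apply_self]
    · intro n _ hn
      rw [hA.apply_of_ne hn.symm]
    · intro hm
      rw [A.proj_eq_zero_of_notMem_supp hm x, map_zero, map_zero, map_zero]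
  have hAq : ∀ i m x, q i (A.proj m x) = A.proj m (φ.proj i (A.proj m x)) := by
    intro i m x
    simp only [hq, LinearMap.sum_apply, Module.End.mul_apply]
    rw [Finset.sum_eq_single m]
    · rw [hA.apply_self]
    · intro n _ hn
      rw [hA.apply_of_ne hn, map_zero, map_zero]
    · intro hm
      rw [A.proj_eq_zero_of_notMem_supp hm x, map_zero, map_zero, map_zero]
  -- Triangularity makes the diagonal part of a product the product of the diagonal parts, so the `q
  -- i` are again orthogonal idempotents.
  have hqq : ∀ i j m x, A.proj m (q i (q j x)) = A.proj m (φ.proj i (φ.proj j (A.proj m x))) := by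
    intro i j m x
    rw [hqA, hqA, hlead i m _ (hφ j m _ (hmem m x))]
  have hfam : IsProjFamily φ.supp q := by
    refine ⟨fun i => LinearMap.ext fun x => A.ext_proj fun m => ?_,
      fun i j hij => LinearMap.ext fun x => A.ext_proj fun m => ?_,
      LinearMap.ext fun x => A.ext_proj fun m => ?_⟩
    · rw [Module.End.mul_apply, hqq, φ.isProjFamily.apply_self, hqA]
    · rw [Module.End.mul_apply, hqq, φ.isProjFamily.apply_of_ne hij, LinearMap.zero_apply,
        map_zero]
    · rw [LinearMap.sum_apply, map_sum, Finset.sum_congr rfl fun i _ => hqA i m x, ← map_sum,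
        φ.isProjFamily.sum_apply, hA.apply_self, Module.End.one_apply]
  have hmul : ∀ i j x y, q (i + j) (μ (q i x) (q j y)) = μ (q i x) (q j y) := by
    intro i j x y
    have hpiece : ∀ m n, q (i + j) (μ (A.proj m (q i x)) (A.proj n (q j y)))
        = μ (A.proj m (q i x)) (A.proj n (q j y)) := by
      intro m n
      rw [hqA, hqA]
      set X := φ.proj i (A.proj m x) with hX
      set Y := φ.proj j (A.proj n y) with hY
      have hXm : X ∈ A.splitFiltration.part m := hφ i m _ (hmem m x)
      have hYn : Y ∈ A.splitFiltration.part n := hφ j n _ (hmem n y)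
      rw [← A.proj_add_mul (A.mem_splitFiltration.1 hXm) (A.mem_splitFiltration.1 hYn), hAq,
        hlead _ _ _ (A.splitFiltration.mul_mem m n X Y hXm hYn),
        φ.proj_of_mem (φ.mul_mem i j X Y (φ.proj_mem _ _) (φ.proj_mem _ _))]
    rw [← hA.sum_apply (q i x), ← hA.sum_apply (q j y)]
    simp only [map_sum, LinearMap.sum_apply]
    exact Finset.sum_congr rfl fun m _ => Finset.sum_congr rfl fun n _ => hpiece _ _
  refine ⟨ofProj hfam hmul, fun m i => ?_, fun i m x hx => ?_, fun θ h1 h2 i => ?_⟩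
  · rw [proj_ofProj]
    refine LinearMap.ext fun x => ?_
    rw [Module.End.mul_apply, Module.End.mul_apply, hqA, hAq]
  · rw [proj_ofProj, mem_splitFiltration]
    intro d hd
    rw [LinearMap.sub_apply, map_sub, hqA, sub_eq_zero]
    rcases eq_or_ne d m with rfl | hne
    · rw [hlead i d x hx]
    · rw [A.mem_splitFiltration.1 hx d (by omega), map_zero, map_zero,
        A.mem_splitFiltration.1 (hφ i m x hx) d (by omega)]
  · rw [proj_ofProj]
    exact Commute.sum_right _ _ _ fun m _ => (h1 m).mul_right ((h2 i).mul_right (h1 m))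

/-- If a grading preserves the split filtration of `A`, then this filtration is also split by a
grading that commutes with it. -/
theorem exists_commuting_splitting (A φ : GradingOperator μ)
    (hφ : ∀ i, φ.proj i ∈ A.splitFiltration.stabilizer) :
    ∃ B : GradingOperator μ, B.splitFiltration = A.splitFiltration ∧ φ.Commutes B ∧
      ∀ θ : Module.End k V, (∀ i, Commute θ (A.proj i)) → (∀ i, Commute θ (φ.proj i)) →
        ∀ i, Commute θ (B.proj i) := by
  obtain ⟨φ', hcomm, hshift, hθ⟩ := exists_commuting_associate A φ hφ
  have hφ' : ∀ i, φ'.proj i ∈ A.splitFiltration.stabilizer := by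
    intro i
    have h1 : φ'.proj i = φ.proj i - (φ.proj i - φ'.proj i) := by abel
    rw [h1]
    exact Subalgebra.sub_mem _ (hφ i) (AlgFiltration.mem_stabilizer_of_mem_shifting (hshift i))
  obtain ⟨g, hgmul, hgφ, hgs, hgs', hgθ⟩ :=
    exists_automorphism_of_sub_mem_shifting hφ hφ' hshift
  have hA := A.isProjFamily
  set g' : Module.End k V := ((g⁻¹ : (Module.End k V)ˣ) : Module.End k V) with hg'
  have hgg' : (g : Module.End k V) * g' = 1 := g.mul_inv
  have hg'g : g' * (g : Module.End k V) = 1 := g.inv_mul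
  have hgg'a : ∀ x, (g : Module.End k V) (g' x) = x := fun x => LinearMap.congr_fun hgg' x
  have hg'ga : ∀ x, g' ((g : Module.End k V) x) = x := fun x => LinearMap.congr_fun hg'g x
  -- The conjugate of `A` by `g`. It commutes with `φ = g φ' g⁻¹` because `A` commutes with `φ'`,
  -- and splits the same filtration because `g` and `g⁻¹` preserve it.
  set b : ℤ → Module.End k V := fun m => (g : Module.End k V) * A.proj m * g' with hb
  have hba : ∀ m x, b m x = (g : Module.End k V) (A.proj m (g' x)) := fun m x => rfl
  have hfam : IsProjFamily A.supp b := by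
    refine ⟨fun i => LinearMap.ext fun x => ?_, fun i j hij => LinearMap.ext fun x => ?_, ?_⟩
    · rw [Module.End.mul_apply, hba, hba, hg'ga, hA.apply_self]
    · rw [Module.End.mul_apply, hba, hba, hg'ga, hA.apply_of_ne hij, map_zero,
        LinearMap.zero_apply]
    · simp only [hb]
      rw [← Finset.sum_mul, ← Finset.mul_sum, hA.sum_eq, mul_one, hgg']
  have hmul : ∀ i j x y, b (i + j) (μ (b i x) (b j y)) = μ (b i x) (b j y) := by
    intro i j x y
    rw [hba i, hba j, ← hgmul, hba, hg'ga,
      A.proj_of_mem (A.mul_mem i j _ _ (A.proj_mem _ _) (A.proj_mem _ _))]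
  refine ⟨ofProj hfam hmul, AlgFiltration.eq_of_part_eq (funext fun m => ?_), fun i m => ?_,
    fun θ h1 h2 m => ?_⟩
  · ext x
    have h1 : x ∈ (ofProj hfam hmul).splitFiltration.part m
        ↔ g' x ∈ A.splitFiltration.part m := by
      rw [mem_splitFiltration, mem_splitFiltration]
      refine forall₂_congr fun d _ => ?_
      rw [proj_ofProj, hba]
      constructor
      · intro h
        rw [← hg'ga (A.proj d (g' x)), h, map_zero]
      · intro h
        rw [h, map_zero]
    rw [h1]
    constructor
    · intro h
      rw [← hgg'a x]
      exact hgs m _ h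
    · exact hgs' m x
  · rw [proj_ofProj]
    have h1 : φ'.proj i * g' = g' * φ.proj i := by
      calc φ'.proj i * g' = g' * (g * φ'.proj i) * g' := by
            rw [← mul_assoc, hg'g, one_mul]
        _ = g' * φ.proj i := by
            rw [← hgφ, mul_assoc, mul_assoc, hgg', mul_one]
    change φ.proj i * (g * A.proj m * g') = g * A.proj m * g' * φ.proj i
    calc φ.proj i * (g * A.proj m * g') = (φ.proj i * g) * A.proj m * g' := by
          simp only [mul_assoc]
      _ = g * (φ'.proj i * A.proj m) * g' := by rw [hgφ]; simp only [mul_assoc]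
      _ = g * A.proj m * (φ'.proj i * g') := by
          rw [← (hcomm m i).eq]; simp only [mul_assoc]
      _ = g * A.proj m * g' * φ.proj i := by rw [h1]; simp only [mul_assoc]
  · rw [proj_ofProj]
    have h3 := hgθ θ h2 (hθ θ h1 h2)
    exact (h3.mul_right (h1 m)).mul_right h3.units_inv_right

end GradingOperator

/-! ### Uniqueness of the canonical filtration -/

namespace AlgFiltration

variable {k : Type u} {V : Type v} [Field k] [AddCommGroup V] [Module k V]
  {μ : V →ₗ[k] V →ₗ[k] V}

theorem norm_nonneg (F : AlgFiltration μ) : 0 ≤ F.norm := Real.sqrt_nonneg _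

variable [FiniteDimensional k V]

theorem exists_common_adapted (F G : AlgFiltration μ) :
    ∃ (n : ℕ) (e : Module.Basis (Fin n) k V) (f g : Fin n → ℤ),
      F.IsAdapted e f ∧ G.IsAdapted e g :=
  exists_common_weighted_basis F.part G.part (fun i j h => F.anti i j h)
    (fun i j h => G.anti i j h) F.eventually_top F.eventually_bot G.eventually_top
    G.eventually_bot

theorem not_isTrivial_of_wt_pos {G : AlgFiltration μ} (hG : 0 < G.wt) : ¬ G.IsTrivial := by
  intro h
  obtain ⟨n, e, f, -, hf, -⟩ := G.exists_common_adapted G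
  rw [hf.wt_eq, Finset.sum_eq_zero fun a _ => by rw [hf.eq_zero_of_isTrivial h a, Int.cast_zero]]
    at hG
  exact lt_irrefl _ hG

theorem norm_pos_of_wt_pos {G : AlgFiltration μ} (hG : 0 < G.wt) : 0 < G.norm := by
  refine lt_of_le_of_ne G.norm_nonneg fun h => ?_
  obtain ⟨n, e, f, -, hf, -⟩ := G.exists_common_adapted G
  have h1 := hf.norm_sq_eq
  rw [← h, zero_pow two_ne_zero, eq_comm,
    Finset.sum_eq_zero_iff_of_nonneg fun a _ => sq_nonneg _] at h1
  rw [hf.wt_eq, Finset.sum_eq_zero fun a ha => pow_eq_zero_iff two_ne_zero |>.1 (h1 a ha)] at hG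
  exact lt_irrefl _ hG

/-- In an unstable algebra, the canonical filtration has positive weight and maximizes the ratio of
weight and norm. -/
theorem IsCanonical.wt_pos_and_le {F : AlgFiltration μ} (hF : F.IsCanonical)
    (hss : ¬ AlgSemistable μ) :
    0 < F.wt ∧ ∀ G : AlgFiltration μ, 0 < G.wt → G.wt ^ 2 * F.norm ^ 2 ≤ F.wt ^ 2 * G.norm ^ 2 := by
  obtain ⟨h, -⟩ | ⟨-, -, hmin⟩ := hF
  · exact absurd h hss
  have hratio : ∀ G : AlgFiltration μ, 0 < G.wt → 0 < F.wt ∧ 0 < F.norm ∧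
      G.wt * F.norm ≤ F.wt * G.norm := by
    intro G hG
    have h1 := hmin G (not_isTrivial_of_wt_pos hG)
    unfold numInvariant at h1
    rw [neg_div, neg_div, neg_le_neg_iff] at h1
    have h2 : 0 < F.wt / F.norm := (div_pos hG (norm_pos_of_wt_pos hG)).trans_le h1
    have h3 : 0 < F.norm := by
      -- With norm zero the quotient would be `0` by the convention for division, against `h2`.
      refine lt_of_le_of_ne F.norm_nonneg fun h => ?_
      rw [← h, div_zero] at h2
      exact lt_irrefl _ h2
    have h4 : 0 < F.wt := (div_pos_iff_of_pos_right h3).1 h2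
    exact ⟨h4, h3, (div_le_div_iff₀ (norm_pos_of_wt_pos hG) h3).1 h1⟩
  constructor
  · unfold AlgSemistable at hss
    push Not at hss
    obtain ⟨G, hG⟩ := hss
    exact (hratio G (by linarith)).1
  · intro G hG
    obtain ⟨-, h2, h3⟩ := hratio G hG
    rw [← mul_pow, ← mul_pow]
    exact pow_le_pow_left₀ (mul_pos hG h2).le h3 2

/-- In an unstable algebra, a canonical filtration is determined by its weight and norm. -/
theorem IsCanonical.eq_of_wt_eq_of_norm_eq {F G : AlgFiltration μ} (hF : F.IsCanonical)
    (hss : ¬ AlgSemistable μ) (hwt : G.wt = F.wt) (hnorm : G.norm = F.norm) : G = F := by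
  obtain ⟨hpos, hle⟩ := hF.wt_pos_and_le hss
  obtain ⟨n, e, f, g, hf, hg⟩ := F.exists_common_adapted G
  -- The midpoint of `F` and `G`, doubled to keep the weights integral.
  let H : AlgFiltration μ := ofBasis e (fun a => f a + g a) fun a b c h => by
    by_cases h1 : f c < f a + f b
    · exact hf.repr_mul_eq_zero h1
    · exact hg.repr_mul_eq_zero (by omega)
  have hH : H.IsAdapted e fun a => f a + g a := ofBasis_isAdapted _ _ _
  have hHwt : H.wt = 2 * F.wt := by
    rw [hH.wt_eq, two_mul]
    nth_rewrite 2 [← hwt]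
    rw [hf.wt_eq, hg.wt_eq, ← Finset.sum_add_distrib]
    simp
  have h1 := hle H (by linarith)
  rw [hHwt] at h1
  -- Since `H` has twice the weight of `F`, maximality of the ratio forces at least twice the norm.
  have h2 : 4 * F.norm ^ 2 ≤ H.norm ^ 2 := by
    have h3 : F.wt ^ 2 * (4 * F.norm ^ 2) ≤ F.wt ^ 2 * H.norm ^ 2 := by linarith
    exact le_of_mul_le_mul_left h3 (by positivity)
  -- The parallelogram law, with the norms of `F` and `G` equal.
  have h3 : ∑ a, ((f a : ℝ) - g a) ^ 2 + H.norm ^ 2 = 4 * F.norm ^ 2 := by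
    have h4 : 4 * F.norm ^ 2 = 2 * F.norm ^ 2 + 2 * G.norm ^ 2 := by
      rw [hnorm]
      ring
    rw [h4, hH.norm_sq_eq, hf.norm_sq_eq, hg.norm_sq_eq, Finset.mul_sum, Finset.mul_sum,
      ← Finset.sum_add_distrib, ← Finset.sum_add_distrib]
    refine Finset.sum_congr rfl fun a _ => ?_
    push_cast
    ring
  have h4 : ∑ a, ((f a : ℝ) - g a) ^ 2 = 0 :=
    le_antisymm (by linarith) (Finset.sum_nonneg fun a _ => sq_nonneg _)
  rw [Finset.sum_eq_zero_iff_of_nonneg fun a _ => sq_nonneg _] at h4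
  have h5 : f = g := funext fun a => by
    have h6 := pow_eq_zero_iff two_ne_zero |>.1 (h4 a (Finset.mem_univ a))
    exact_mod_cast sub_eq_zero.1 h6
  refine eq_of_part_eq (funext fun m => ?_)
  rw [hf m, hg m, h5]

end AlgFiltration

/-! ### Traces in homogeneous bases -/

namespace GradingOperator

variable {k : Type u} {V : Type v} [Field k] [AddCommGroup V] [Module k V]
  {μ : V →ₗ[k] V →ₗ[k] V}

section HomogeneousBasis

variable {ι : Type*} [Fintype ι] {φ ψ : GradingOperator μ} {e : Module.Basis ι k V} {f g : ι → ℤ}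

theorem repr_proj (hf : ∀ a, e a ∈ φ.piece (f a)) (i : ℤ) (x : V) (a : ι) :
    e.repr (φ.proj i x) a = if f a = i then e.repr x a else 0 := by
  have h1 : φ.proj i x = ∑ a, (if f a = i then e.repr x a else 0) • e a := by
    conv_lhs => rw [← e.sum_repr x, map_sum]
    refine Finset.sum_congr rfl fun b _ => ?_
    rw [map_smul]
    split_ifs with h
    · rw [φ.proj_of_mem (h ▸ hf b)]
    · rw [φ.proj_of_mem_ne h (hf b), smul_zero, zero_smul]
  rw [h1, e.repr_sum_self]

theorem mem_piece_iff_repr (hf : ∀ a, e a ∈ φ.piece (f a)) {i : ℤ} {x : V} :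
    x ∈ φ.piece i ↔ ∀ a, f a ≠ i → e.repr x a = 0 := by
  rw [mem_piece_iff, ← e.repr.injective.eq_iff, Finsupp.ext_iff]
  refine forall_congr' fun a => ?_
  rw [repr_proj hf]
  by_cases h : f a = i
  · simp [h]
  · simp [h, eq_comm]

theorem gtraceComp_eq_sum (hf : ∀ a, e a ∈ φ.piece (f a)) (hg : ∀ a, e a ∈ ψ.piece (g a)) :
    φ.gtraceComp ψ = ∑ a, f a * g a := by
  have h1 : ∀ p : ℤ × ℤ, (Module.finrank k (φ.piece p.1 ⊓ ψ.piece p.2 : Submodule k V) : ℤ)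
      = ((Finset.univ.filter fun a => (f a, g a) = p).card : ℤ) := by
    intro p
    rw [← e.finrank_span_image]
    suffices h : φ.piece p.1 ⊓ ψ.piece p.2 = Submodule.span k (e '' {a | (f a, g a) = p}) by
      rw [h]
    ext x
    rw [Submodule.mem_inf, mem_piece_iff_repr hf, mem_piece_iff_repr hg,
      Module.Basis.mem_span_image]
    constructor
    · rintro ⟨h2, h3⟩ a ha
      rw [Finset.mem_coe, Finsupp.mem_support_iff] at ha
      exact Prod.ext (by_contra fun h => ha (h2 a h)) (by_contra fun h => ha (h3 a h))
    · intro h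
      refine ⟨fun a ha => ?_, fun a ha => ?_⟩ <;>
      · by_contra hne
        have h2 : (f a, g a) = p := h (Finsupp.mem_support_iff.2 hne)
        exact ha (by rw [← h2])
  unfold gtraceComp
  simp_rw [h1]
  exact finsum_mul_card_fiber (fun a => (f a, g a)) fun p : ℤ × ℤ => p.1 * p.2

theorem gtrace_eq_sum (hf : ∀ a, e a ∈ φ.piece (f a)) : φ.gtrace = ∑ a, f a := by
  have h1 : ∀ i, (Module.finrank k (φ.piece i) : ℤ)
      = ((Finset.univ.filter fun a => f a = i).card : ℤ) := by
    intro i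
    rw [← e.finrank_span_image]
    suffices h : φ.piece i = Submodule.span k (e '' {a | f a = i}) by
      rw [h]
    ext x
    rw [mem_piece_iff_repr hf, Module.Basis.mem_span_image]
    constructor
    · intro h2 a ha
      rw [Finset.mem_coe, Finsupp.mem_support_iff] at ha
      exact by_contra fun h => ha (h2 a h)
    · intro h a ha
      by_contra hne
      exact ha (h (Finsupp.mem_support_iff.2 hne))
  unfold gtrace
  simp_rw [h1]
  exact finsum_mul_card_fiber f fun i => i

theorem normB_sq (hf : ∀ a, e a ∈ φ.piece (f a)) : φ.normB ^ 2 = ∑ a, (f a : ℝ) ^ 2 := by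
  have h1 : (φ.gtraceComp φ : ℝ) = ∑ a, (f a : ℝ) ^ 2 := by
    rw [gtraceComp_eq_sum hf hf]
    push_cast
    exact Finset.sum_congr rfl fun a _ => (sq _).symm
  rw [normB, h1, Real.sq_sqrt (Finset.sum_nonneg fun a _ => sq_nonneg _)]

end HomogeneousBasis

variable [FiniteDimensional k V]

theorem splitFiltration_isAdapted {ι : Type*} [Fintype ι] {φ : GradingOperator μ}
    {e : Module.Basis ι k V} {f : ι → ℤ} (hf : ∀ a, e a ∈ φ.piece (f a)) :
    φ.splitFiltration.IsAdapted e f := by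
  intro m
  ext x
  rw [mem_splitFiltration]
  constructor
  · intro h a ha
    have h1 := repr_proj hf (f a) x a
    rwa [h _ ha, if_pos rfl, map_zero, Finsupp.zero_apply, eq_comm] at h1
  · intro h d hd
    rw [← e.forall_coord_eq_zero_iff]
    intro a
    rw [e.coord_apply, repr_proj hf]
    split_ifs with h1
    · exact h a (h1 ▸ hd)
    · rfl

/-! ### Degeneration along a grading and homogeneity -/

/-- The leading components of a basis adapted to the split filtration of `φ` form a basis. -/
theorem exists_leading_basis (φ : GradingOperator μ) {n : ℕ} {e : Module.Basis (Fin n) k V}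
    {g : Fin n → ℤ} (h : φ.splitFiltration.IsAdapted e g) :
    ∃ e' : Module.Basis (Fin n) k V, (∀ a, e' a = φ.proj (g a) (e a)) ∧
      ∀ d x, x ∈ φ.splitFiltration.part d →
        ∀ a, e'.repr (φ.proj d x) a = if g a = d then e.repr x a else 0 := by
  have hproj : ∀ a d, d ≤ g a → φ.proj d (e a) = if g a = d then φ.proj (g a) (e a) else 0 := by
    intro a d hd
    split_ifs with h1
    · rw [h1]
    · have h2 : e a ∈ φ.splitFiltration.part (g a) := by
        rw [h]
        exact e.self_mem_weightGE g le_rfl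
      exact φ.mem_splitFiltration.1 h2 d (by omega)
  have hsum : ∀ d x, x ∈ φ.splitFiltration.part d →
      φ.proj d x = ∑ a, (if g a = d then e.repr x a else 0) • φ.proj (g a) (e a) := by
    intro d x hx
    conv_lhs => rw [← e.sum_repr x, map_sum]
    refine Finset.sum_congr rfl fun a _ => ?_
    rw [map_smul]
    rcases lt_or_ge (g a) d with h1 | h1
    · rw [h] at hx
      rw [hx a h1, zero_smul, if_neg h1.ne, zero_smul]
    · rw [hproj a d h1]
      split_ifs <;> simp
  have hli : LinearIndependent k fun a => φ.proj (g a) (e a) := by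
    rw [Fintype.linearIndependent_iff]
    intro c hc a
    -- The terms of the relation with leading degree `g a`. Their leading components cancel, so `y`
    -- lies one step deeper, where its coordinate at `a` must vanish.
    set y := ∑ b, (if g b = g a then c b else 0) • e b with hy
    have hrepr : ∀ b, e.repr y b = if g b = g a then c b else 0 := fun b => by
      rw [hy, e.repr_sum_self]
    have hyd : y ∈ φ.splitFiltration.part (g a) := by
      rw [h]
      intro b hb
      rw [hrepr, if_neg hb.ne]
    have hy0 : φ.proj (g a) y = 0 := by
      have h1 := congrArg (φ.proj (g a)) hc
      rw [map_sum, map_zero] at h1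
      rw [hsum _ _ hyd, ← h1]
      refine Finset.sum_congr rfl fun b _ => ?_
      rw [hrepr, map_smul]
      by_cases hb : g b = g a
      · rw [if_pos hb, if_pos hb, hb, φ.isProjFamily.apply_self]
      · rw [if_neg hb, zero_smul, φ.isProjFamily.apply_of_ne (Ne.symm hb), smul_zero]
    have hyd' : y ∈ φ.splitFiltration.part (g a + 1) := by
      rw [mem_splitFiltration] at hyd ⊢
      intro d hd
      rcases eq_or_ne d (g a) with rfl | hne
      · exact hy0
      · exact hyd d (by omega)
    rw [h] at hyd'
    have h2 := hyd' a (by omega)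
    rwa [hrepr, if_pos rfl] at h2
  have hspan := hli.span_eq_top_of_card_eq_finrank' (Module.finrank_eq_card_basis e).symm
  refine ⟨Module.Basis.mk hli hspan.ge, fun a => Module.Basis.mk_apply _ _ a,
    fun d x hx a => ?_⟩
  have h1 : φ.proj d x
      = ∑ a, (if g a = d then e.repr x a else 0) • (Module.Basis.mk hli hspan.ge) a := by
    rw [hsum d x hx]
    exact Finset.sum_congr rfl fun a _ => by rw [Module.Basis.mk_apply]
  rw [h1, Module.Basis.repr_sum_self]

/-- The canonical filtration is homogeneous for every grading of the algebra. -/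
theorem proj_mem_stabilizer_of_isCanonical {F : AlgFiltration μ} (hF : F.IsCanonical)
    (φ : GradingOperator μ) (i : ℤ) : φ.proj i ∈ F.stabilizer := by
  by_cases hss : AlgSemistable μ
  · obtain ⟨-, h⟩ | ⟨h, -⟩ := hF
    · intro m x hx
      rcases le_or_gt m 0 with hm | hm
      · rw [h.1 m hm]
        trivial
      · rw [h.2 m hm, Submodule.mem_bot] at hx
        rw [hx, map_zero]
        exact Submodule.zero_mem _
    · exact absurd hss h
  obtain ⟨n, e, f, g, hf, hg⟩ := F.exists_common_adapted φ.splitFiltration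
  obtain ⟨e', he', hrepr⟩ := φ.exists_leading_basis hg
  have hmem : ∀ a, e a ∈ φ.splitFiltration.part (g a) := fun a => by
    rw [hg]
    exact e.self_mem_weightGE g le_rfl
  -- Each structure constant of the leading basis is zero or the corresponding one of `e`, so the
  -- weights `f` remain admissible.
  let G : AlgFiltration μ := AlgFiltration.ofBasis e' f fun a b c hc => by
    rw [he', he', ← φ.proj_add_mul (φ.mem_splitFiltration.1 (hmem a))
      (φ.mem_splitFiltration.1 (hmem b)),
      hrepr _ _ (φ.splitFiltration.mul_mem _ _ _ _ (hmem a) (hmem b)), hf.repr_mul_eq_zero hc,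
      ite_self]
  have hG : G.IsAdapted e' f := AlgFiltration.ofBasis_isAdapted _ _ _
  have hwt : G.wt = F.wt := by rw [hG.wt_eq, hf.wt_eq]
  have hnorm : G.norm = F.norm := by
    rw [← sq_eq_sq₀ G.norm_nonneg F.norm_nonneg, hG.norm_sq_eq, hf.norm_sq_eq]
  -- By uniqueness `F` equals its degeneration `G`, which has a `φ`-homogeneous adapted basis.
  rw [← hF.eq_of_wt_eq_of_norm_eq hss hwt hnorm]
  intro m x hx
  rw [hG] at hx ⊢
  rw [← e'.sum_repr x, map_sum]
  refine Submodule.sum_mem _ fun a _ => ?_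
  rw [map_smul]
  rcases lt_or_ge (f a) m with h1 | h1
  · rw [hx a h1, zero_smul]
    exact Submodule.zero_mem _
  · refine Submodule.smul_mem _ _ ?_
    by_cases h2 : i = g a
    · rw [h2, he', φ.isProjFamily.apply_self, ← he']
      exact e'.self_mem_weightGE f h1
    · rw [he', φ.isProjFamily.apply_of_ne h2]
      exact Submodule.zero_mem _

/-! ### Commuting gradings and the first variation -/

/-- Commuting gradings have a basis of simultaneously homogeneous elements. -/
theorem Commutes.exists_homogeneous_basis {φ ψ : GradingOperator μ} (h : φ.Commutes ψ) :
    ∃ (n : ℕ) (e : Module.Basis (Fin n) k V) (f g : Fin n → ℤ),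
      (∀ a, e a ∈ φ.piece (f a)) ∧ ∀ a, e a ∈ ψ.piece (g a) := by
  have hψφ : ∀ i j x, ψ.proj j (φ.proj i x) = φ.proj i (ψ.proj j x) := fun i j x =>
    (LinearMap.congr_fun (h i j) x).symm
  have hfam : IsProjFamily (φ.supp ×ˢ ψ.supp)
      (fun p : ℤ × ℤ => φ.proj p.1 * ψ.proj p.2) := by
    refine ⟨fun p => LinearMap.ext fun x => ?_, fun p q hpq => LinearMap.ext fun x => ?_, ?_⟩
    · simp only [Module.End.mul_apply, hψφ, φ.isProjFamily.apply_self, ψ.isProjFamily.apply_self]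
    · simp only [Module.End.mul_apply, hψφ]
      by_cases h1 : p.1 = q.1
      · rw [ψ.isProjFamily.apply_of_ne fun h2 => hpq (Prod.ext h1 h2), map_zero, map_zero,
          LinearMap.zero_apply]
      · rw [φ.isProjFamily.apply_of_ne h1, LinearMap.zero_apply]
    · rw [Finset.sum_product, ← Finset.sum_mul_sum, φ.isProjFamily.sum_eq,
        ψ.isProjFamily.sum_eq, one_mul]
  have hint := hfam.isInternal
  let B := hint.collectedBasis fun p => Module.finBasis k _
  have := Module.Finite.finite_basis B
  have := Fintype.ofFinite
    (Σ p : ℤ × ℤ, Fin (Module.finrank k (LinearMap.range (φ.proj p.1 * ψ.proj p.2))))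
  let σ := Fintype.equivFin
    (Σ p : ℤ × ℤ, Fin (Module.finrank k (LinearMap.range (φ.proj p.1 * ψ.proj p.2))))
  have hmem : ∀ x, ∃ y, B.reindex σ x
      = φ.proj (σ.symm x).1.1 (ψ.proj (σ.symm x).1.2 y) := by
    intro x
    rw [Module.Basis.reindex_apply]
    obtain ⟨y, hy⟩ := hint.collectedBasis_mem (fun p => Module.finBasis k _) (σ.symm x)
    exact ⟨y, hy.symm⟩
  refine ⟨_, B.reindex σ, fun x => (σ.symm x).1.1, fun x => (σ.symm x).1.2, fun x => ?_,
    fun x => ?_⟩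
  · obtain ⟨y, hy⟩ := hmem x
    rw [hy]
    exact φ.proj_mem _ _
  · obtain ⟨y, hy⟩ := hmem x
    rw [hy, ← hψφ]
    exact ψ.proj_mem _ _

theorem Commutes.refl (φ : GradingOperator μ) : φ.Commutes φ := by
  intro i j
  by_cases h : i = j
  · rw [h]
  · rw [Commute, SemiconjBy, φ.isProjFamily.mul_of_ne i j h,
      φ.isProjFamily.mul_of_ne j i (Ne.symm h)]

theorem gtrace_eq_wt (φ : GradingOperator μ) : (φ.gtrace : ℝ) = φ.splitFiltration.wt := by
  obtain ⟨n, e, f, -, hf, -⟩ := (Commutes.refl φ).exists_homogeneous_basis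
  rw [gtrace_eq_sum hf, (splitFiltration_isAdapted hf).wt_eq, Int.cast_sum]

theorem isTrivial_of_splitFiltration {φ : GradingOperator μ} (h : φ.splitFiltration.IsTrivial) :
    φ.IsTrivial := by
  obtain ⟨n, e, f, -, hf, -⟩ := (Commutes.refl φ).exists_homogeneous_basis
  refine eq_top_iff.2 fun x _ => (mem_piece_iff_repr hf).2 fun a ha => ?_
  exact absurd ((splitFiltration_isAdapted hf).eq_zero_of_isTrivial h a) ha

/-- The first-order condition for a canonical grading. -/
theorem gtraceComp_eq_of_isCanonical {φ ψ : GradingOperator μ}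
    (hss : ¬ AlgSemistable μ) (hφ : φ.splitFiltration.IsCanonical) (h : φ.Commutes ψ) :
    (φ.gtraceComp ψ : ℝ) = φ.normB ^ 2 / (φ.gtrace : ℝ) * (ψ.gtrace : ℝ) := by
  obtain ⟨n, e, f, g, hf, hg⟩ := h.exists_homogeneous_basis
  obtain ⟨hpos, hle⟩ := hφ.wt_pos_and_le hss
  have hFad := splitFiltration_isAdapted hf
  rw [← gtrace_eq_wt] at hpos hle
  set w : ℝ := ((φ.gtrace : ℤ) : ℝ)
  set w' : ℝ := ((ψ.gtrace : ℤ) : ℝ)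
  set N : ℝ := φ.normB ^ 2
  set B : ℝ := ((φ.gtraceComp ψ : ℤ) : ℝ)
  have hw : w = ∑ a, (f a : ℝ) := by simp [w, gtrace_eq_sum hf]
  have hw' : w' = ∑ a, (g a : ℝ) := by simp [w', gtrace_eq_sum hg]
  have hN : N = ∑ a, (f a : ℝ) ^ 2 := normB_sq hf
  have hB : B = ∑ a, (f a : ℝ) * g a := by simp [B, gtraceComp_eq_sum hf hg]
  have hFn : φ.splitFiltration.norm ^ 2 = N := by rw [hFad.norm_sq_eq, hN]
  rw [hFn] at hle
  have hmul : ∀ a b c, e.repr (μ (e a) (e b)) c ≠ 0 → f c = f a + f b ∧ g c = g a + g b := by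
    intro a b c hc
    have h1 := (mem_piece_iff_repr hf).1 (φ.mul_mem _ _ _ _ (hf a) (hf b)) c
    have h2 := (mem_piece_iff_repr hg).1 (ψ.mul_mem _ _ _ _ (hg a) (hg b)) c
    exact ⟨by_contra fun h => hc (h1 h), by_contra fun h => hc (h2 h)⟩
  -- Compare `φ` with the integral weights `t f + s g` for large `t`, which stand for `f + (s / t)
  -- g`. The terms in `t ^ 2` cancel and the linear term must be nonpositive.
  have hvar : ∀ s : ℤ, (s : ℝ) * (w * w' * N - w ^ 2 * B) ≤ 0 := by
    intro s
    -- The bound on `t` makes the weight `t w + s w'` positive, and `C` is half of the terms free of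
    -- `t`.
    refine nonpos_of_forall_natCast_mul_le (N := (1 + |s * w'|) / w)
      (C := (w ^ 2 * s ^ 2 * (∑ a, (g a : ℝ) ^ 2) - (s * w') ^ 2 * N) / 2) fun t ht => ?_
    -- Nonzero structure constants satisfy equalities of degrees, not just inequalities, so negative
    -- `s` is allowed too.
    let H : AlgFiltration μ := AlgFiltration.ofBasis e (fun a => t * f a + s * g a)
      fun a b c hc => by
        by_contra hne
        obtain ⟨h1, h2⟩ := hmul a b c hne
        rw [h1, h2] at hc
        exact absurd hc (by ring_nf; exact lt_irrefl _)
    have hH : H.IsAdapted e fun a => t * f a + s * g a := AlgFiltration.ofBasis_isAdapted _ _ _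
    have hHwt : H.wt = t * w + s * w' := by
      rw [hH.wt_eq, hw, hw', Finset.mul_sum, Finset.mul_sum, ← Finset.sum_add_distrib]
      push_cast
      rfl
    have hHn : H.norm ^ 2 = t ^ 2 * N + 2 * t * s * B + s ^ 2 * ∑ a, (g a : ℝ) ^ 2 := by
      rw [hH.norm_sq_eq, hN, hB, Finset.mul_sum, Finset.mul_sum, Finset.mul_sum,
        ← Finset.sum_add_distrib, ← Finset.sum_add_distrib]
      push_cast
      exact Finset.sum_congr rfl fun a _ => by ring
    have h1 : 0 < H.wt := by
      rw [hHwt]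
      have h2 := (div_le_iff₀ hpos).1 ht
      have h3 := neg_abs_le (s * w')
      linarith
    have h2 := hle H h1
    rw [hHwt, hHn] at h2
    linarith
  -- Both signs of the variation turn the inequality into an equation.
  have h1 := hvar 1
  have h2 := hvar (-1)
  push_cast at h1 h2
  have h3 : w * (w' * N - w * B) = 0 := by linarith
  have h4 : w' * N - w * B = 0 := (mul_eq_zero.1 h3).resolve_left hpos.ne'
  field_simp
  linarith

end GradingOperator

theorem mainTheorem9 {k : Type u} {V : Type v} [Field k] [PerfectField k] [AddCommGroup V]
    [Module k V] [FiniteDimensional k V] (μ : V →ₗ[k] V →ₗ[k] V)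
    (hμ : IsAssocProduct μ ∨ IsLieProduct μ)
    (A : GradingOperator μ) (hA : A.GradedSemistable)
    (φ : GradingOperator μ) (hφ : ¬ φ.IsTrivial) :
    (∃ φCan ∈ φ.centralizer, φCan.splitFiltration = A.splitFiltration) ∧
    ∀ ψ ∈ φ.centralizer,
      (∃ φCan ∈ φ.centralizer, ψ ∈ φCan.centralizer ∧
        φCan.splitFiltration = A.splitFiltration) ∧
      (¬ A.IsTrivial → ∀ φCan : GradingOperator μ, φCan.splitFiltration.IsCanonical →
        0 < φCan.gtrace ∧
        (ψ ∈ φCan.centralizer →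
          (φCan.gtraceComp ψ : ℝ) = φCan.normB ^ 2 / (φCan.gtrace : ℝ) * (ψ.gtrace : ℝ))) := by
  obtain ⟨B, hBA, hφB, -⟩ := GradingOperator.exists_commuting_splitting A φ
    (GradingOperator.proj_mem_stabilizer_of_isCanonical hA φ)
  refine ⟨⟨B, hφB, hBA⟩, fun ψ hψ => ⟨?_, fun hnt φCan hCan => ?_⟩⟩
  · have hB : B.splitFiltration.IsCanonical := by
      rw [hBA]
      exact hA
    -- The projections of `φ` commute with those of `B` and `ψ`, hence with those of the new
    -- splitting `C`.
    obtain ⟨C, hCB, hψC, hC⟩ := GradingOperator.exists_commuting_splitting B ψ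
      (GradingOperator.proj_mem_stabilizer_of_isCanonical hB ψ)
    exact ⟨C, fun i => hC _ (hφB i) (hψ i), fun i j => (hψC j i).symm, hCB.trans hBA⟩
  · have hss : ¬ AlgSemistable μ := by
      intro hss
      obtain ⟨-, h⟩ | ⟨h, -⟩ := hA
      · exact hnt (GradingOperator.isTrivial_of_splitFiltration h)
      · exact h hss
    refine ⟨?_, fun h => GradingOperator.gtraceComp_eq_of_isCanonical hss hCan h⟩
    have h1 := (hCan.wt_pos_and_le hss).1
    rw [← GradingOperator.gtrace_eq_wt] at h1
    exact_mod_cast h1
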